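/- **Setting.** Let $I$ be a non-empty locally finite directed poset: any two elements of $I$ have a common upper bound and all intervals $[i,j]$ are finite. An *$I$-indexed algebra* $A=\bigoplus_{i,j\in I}A_{ij}$ consists of abelian groups $A_{ij}$ with units $e_i\in A_{ii}$ and biadditive, associative and unital multiplications $A_{ij}\times A_{jl}\to A_{il}$ (i.e. it is a preadditive category with objects indexed by $I$). Assume that $A$ is connected (each $A_{ii}$ is a division ring) and positively indexed ($A_{ij}\neq 0$ only if $i\le j$). Let $\mathsf{Gr}A$ be the category of right $A$-modules: families of abelian groups $(M_i)_{i\in I}$ with additive, associative and unital actions $M_i\times A_{ij}\to M_j$. Put $P_i=e_iA$, so that $(P_i)_j=A_{ij}$; finite direct sums of modules $P_i$ are called *finitely generated free*. A module $M$ is *finitely generated* if it is a quotient of a finitely generated free module; *finitely presented* if there is an exact sequence $F'\to F\to M\to 0$ with $F',F$ finitely generated free; *coherent* if it is finitely generated and the kernel of every homomorphism $F\to M$ with $F$ finitely generated free is finitely generated. For $d\in I$ let $M_{>d}=\bigoplus_{j>d}M_j\subseteq M$. Assume that $A$ is *coherent* (all $P_i$ are coherent) and *tails-cocompact* ($P_i/P_{i,>d}$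 is finitely presented for all $i\le d$ in $I$). Let $\mathsf{gr}A\subseteq\mathsf{Gr}A$ be the full (abelian) subcategory of finitely presented modules and $\iota:\mathsf{gr}A\to\mathsf{Gr}A$ the inclusion. A module $M$ is *upper-bounded* if $M_{>d}=0$ for some $d\in I$, and *torsion* if it is a directed colimit of upper-bounded modules. Let $\mathsf{Tors}A\subseteq\mathsf{Gr}A$ be the (Serre) subcategory of torsion modules, $\mathsf{tors}A=\mathsf{Tors}A\cap\mathsf{gr}A$, and let $$\mathsf{QGr}A=\mathsf{Gr}A/\mathsf{Tors}A,\qquad \mathsf{qgr}A=\mathsf{gr}A/\mathsf{tors}A$$ be the Serre quotient categories with quotient functors $\pi_{\mathsf{QGr}}$ and $\pi_{\mathsf{qgr}}$. An object of a Grothendieck category is *finitely generated* if it is not the supremum of a directed family of proper subobjects, *finitely presented* if $\mathrm{Hom}(X,-)$ preserves directed colimits, and *coherent* if it is finitely presented and all its finitely generated subobjects are finitely presented; $\mathsf{coh}(\mathcal C)$ is the full subcategory of coherent objects of $\mathcal C$, and a Grothendieck category is *locally coherent* if it has a set of coherent generators. **Corollary 3.17.** 1. $\mathsf{tors}A$ is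 a Serre subcategory of $\mathsf{gr}A$, and $\mathsf{Tors}A$ is the closure of $\mathsf{tors}A$ under directed colimits in $\mathsf{Gr}A$: the objects of $\mathsf{Tors}A$ are exactly the directed colimits of objects of $\mathsf{tors}A$, and $\mathsf{Tors}A$ is closed under directed colimits. 2. The functor $\pi_{\mathsf{QGr}}$ has a right adjoint $\omega:\mathsf{QGr}A\to\mathsf{Gr}A$ (the section functor), and $\omega$ commutes with directed colimits. 3. $\mathsf{QGr}A$ is a locally coherent Grothendieck category, and there is an equivalence $\Phi:\mathsf{qgr}A\simeq\mathsf{coh}(\mathsf{QGr}A)$. 4. The equivalence $\Phi$ in 3 can be chosen so that its composition $\underline{\iota}:\mathsf{qgr}A\to\mathsf{QGr}A$ with the inclusion $\mathsf{coh}(\mathsf{QGr}A)\subseteq\mathsf{QGr}A$ is an exact, fully faithful functor with $\pi_{\mathsf{QGr}}\,\iota=\underline{\iota}\,\pi_{\mathsf{qgr}}$. -/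

import Mathlib

open CategoryTheory CategoryTheory.Limits

universe u

namespace NCProj

open ZeroObject

section Abstract

variable {C : Type*} [Category* C] [Abelian C]

/-- Relative to a class `𝓕` of objects (the "finitely generated free" ones): `M` is finitely
generated if it is a quotient of an object of `𝓕`. -/
def FinGen (𝓕 : ObjectProperty C) : ObjectProperty C := fun M =>
  ∃ (F : C) (_ : 𝓕 F) (p : F ⟶ M), Epi p

/-- `M` is finitely presented if there is an exact sequence `F' ⟶ F ⟶ M ⟶ 0` with `F'` and `F`
in `𝓕`. -/
def FinPres (𝓕 : ObjectProperty C) : ObjectProperty C := fun M =>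
  ∃ (F' F : C) (_ : 𝓕 F') (_ : 𝓕 F) (f : F' ⟶ F) (g : F ⟶ M) (w : f ≫ g = 0),
    (ShortComplex.mk f g w).Exact ∧ Epi g

/-- `M` is coherent if it is finitely generated and the kernel of every morphism `F ⟶ M` with `F`
in `𝓕` is finitely generated. -/
def CohMod (𝓕 : ObjectProperty C) : ObjectProperty C := fun M =>
  FinGen 𝓕 M ∧ ∀ (F : C) (_ : 𝓕 F) (f : F ⟶ M), FinGen 𝓕 (kernel f)

variable {𝓕 : ObjectProperty C}

lemma FinGen.of_epi {M N : C} (p : M ⟶ N) [Epi p] (h : FinGen 𝓕 M) : FinGen 𝓕 N := by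
  obtain ⟨F, hF, q, hq⟩ := h
  exact ⟨F, hF, q ≫ p, epi_comp _ _⟩

lemma FinGen.of_cover (h𝓕 : ∀ F G, 𝓕 F → 𝓕 G → 𝓕 (F ⊞ G)) {M N K : C}
    (hM : FinGen 𝓕 M) (hN : FinGen 𝓕 N) (a : M ⟶ K) (b : N ⟶ K)
    (h : Epi (biprod.desc a b)) : FinGen 𝓕 K := by
  obtain ⟨F, hF, p, hp⟩ := hM
  obtain ⟨G, hG, q, hq⟩ := hN
  refine ⟨F ⊞ G, h𝓕 _ _ hF hG, biprod.map p q ≫ biprod.desc a b, ?_⟩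
  have : Epi (biprod.map p q) := inferInstance
  exact epi_comp _ _

/-- Criterion, up to refinements, for a kernel to be finitely generated. -/
lemma finGen_kernel_of_refine {X Y T : C} (f : X ⟶ Y) (hT : FinGen 𝓕 T) (c : T ⟶ X)
    (hc : c ≫ f = 0)
    (h : ∀ ⦃Z : C⦄ (z : Z ⟶ X), z ≫ f = 0 →
      ∃ (Z' : C) (e : Z' ⟶ Z) (_ : Epi e) (t : Z' ⟶ T), e ≫ z = t ≫ c) :
    FinGen 𝓕 (kernel f) := by
  have : Epi (kernel.lift f c hc) := by
    rw [epi_iff_surjective_up_to_refinements]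
    intro Z y
    obtain ⟨Z', e, he, t, ht⟩ := h (y ≫ kernel.ι f) (by simp)
    refine ⟨Z', e, he, t, ?_⟩
    rw [← cancel_mono (kernel.ι f)]
    simpa using ht
  exact hT.of_epi (kernel.lift f c hc)

/-- The kernel of an epimorphism from an object of `𝓕` to a finitely presented object is finitely
generated. -/
lemma FinPres.finGen_kernel
    (h𝓕 : ∀ F G, 𝓕 F → 𝓕 G → 𝓕 (F ⊞ G))
    (hproj : ∀ F, 𝓕 F → Projective F) {Q G : C} (hQ : FinPres 𝓕 Q) (hG : 𝓕 G) (p : G ⟶ Q) [Epi p] :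
    FinGen 𝓕 (kernel p) := by
  obtain ⟨F', F, hF', hF, f, g, w, hex, hg⟩ := hQ
  have := hproj _ hG
  have := hproj _ hF
  let φ : G ⟶ F := Projective.factorThru p g
  let ψ : F ⟶ G := Projective.factorThru g p
  have hφ : φ ≫ g = p := Projective.factorThru_comp _ _
  have hψ : ψ ≫ p = g := Projective.factorThru_comp _ _
  refine finGen_kernel_of_refine p ⟨G ⊞ F', h𝓕 _ _ hG hF', 𝟙 _, inferInstance⟩
    (biprod.desc (𝟙 G - φ ≫ ψ) (f ≫ ψ)) (by ext <;> simp [hφ, hψ, w]) fun Z z hz => ?_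
  obtain ⟨Z', e, he, t, ht⟩ := hex.exact_up_to_refinements (z ≫ φ) (by simp [hφ, hz])
  refine ⟨Z', e, he, biprod.lift (e ≫ z) t, ?_⟩
  have ht' : e ≫ z ≫ φ = t ≫ f := by simpa using ht
  simp [biprod.lift_desc, Preadditive.comp_sub, ← reassoc_of% ht']

lemma CohMod.of_subobject {M N : C} (i : M ⟶ N) [Mono i] (hN : CohMod 𝓕 N) (hM : FinGen 𝓕 M) :
    CohMod 𝓕 M := by
  refine ⟨hM, fun F hF f => ?_⟩
  exact (hN.2 F hF (f ≫ i)).of_epi (kernelCompMono f i).hom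

lemma CohMod.biprod
    (h𝓕 : ∀ F G, 𝓕 F → 𝓕 G → 𝓕 (F ⊞ G)) {M N : C} (hM : CohMod 𝓕 M) (hN : CohMod 𝓕 N) : CohMod 𝓕 (M ⊞ N) := by
  refine ⟨FinGen.of_cover h𝓕 hM.1 hN.1 biprod.inl biprod.inr
    (by rw [show biprod.desc biprod.inl biprod.inr = 𝟙 (M ⊞ N) by cat_disch]; infer_instance), ?_⟩
  intro F hF f
  obtain ⟨G, hG, p, hp⟩ := hM.2 F hF (f ≫ biprod.fst)
  have hq : p ≫ kernel.ι (f ≫ biprod.fst) ≫ f ≫ biprod.fst = 0 := by simp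
  refine finGen_kernel_of_refine f
    (hN.2 G hG (p ≫ kernel.ι (f ≫ biprod.fst) ≫ f ≫ biprod.snd))
    (kernel.ι _ ≫ p ≫ kernel.ι (f ≫ biprod.fst)) ?_ fun Z z hz => ?_
  · ext
    · simp
    · simp
  · obtain ⟨Z', e, he, t, ht⟩ := surjective_up_to_refinements_of_epi p
      (kernel.lift (f ≫ biprod.fst) z (by simp [reassoc_of% hz]))
    have ht' : e ≫ z = t ≫ p ≫ kernel.ι (f ≫ biprod.fst) := by
      simpa using ht =≫ kernel.ι (f ≫ biprod.fst)
    exact ⟨Z', e, he, kernel.lift _ t (by simp [← reassoc_of% ht', reassoc_of% hz]),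
      by simpa using ht'⟩

/-- Biproducts over a sum of index types. -/
noncomputable def biproductSum {ι κ : Type} [Finite ι] [Finite κ] [HasFiniteBiproducts C]
    (f : ι ⊕ κ → C) :
    (⨁ f) ≅ (⨁ fun a => f (.inl a)) ⊞ (⨁ fun a => f (.inr a)) where
  hom := biprod.lift (biproduct.lift fun a => biproduct.π f (.inl a))
    (biproduct.lift fun a => biproduct.π f (.inr a))
  inv := biprod.desc (biproduct.desc fun a => biproduct.ι f (.inl a))
    (biproduct.desc fun a => biproduct.ι f (.inr a))
  hom_inv_id := by
    classical
    refine biproduct.hom_ext _ _ fun b => biproduct.hom_ext' _ _ fun a => ?_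
    have h₁ (a : ι) : biproduct.ι f (.inl a) ≫ biproduct.lift (fun a => biproduct.π f (.inl a)) =
        biproduct.ι (fun a => f (.inl a)) a :=
      biproduct.hom_ext _ _ fun b => by simp [biproduct.ι_π]
    have h₂ (a : κ) : biproduct.ι f (.inr a) ≫ biproduct.lift (fun a => biproduct.π f (.inr a)) =
        biproduct.ι (fun a => f (.inr a)) a :=
      biproduct.hom_ext _ _ fun b => by simp [biproduct.ι_π]
    have h₃ (a : ι) : biproduct.ι f (.inl a) ≫
        biproduct.lift (fun a => biproduct.π f (.inr a)) = 0 :=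
      biproduct.hom_ext _ _ fun b => by simp
    have h₄ (a : κ) : biproduct.ι f (.inr a) ≫
        biproduct.lift (fun a => biproduct.π f (.inl a)) = 0 :=
      biproduct.hom_ext _ _ fun b => by simp
    rcases a with a | a
    · simp [reassoc_of% (h₁ a), reassoc_of% (h₃ a)]
    · simp [reassoc_of% (h₂ a), reassoc_of% (h₄ a)]
  inv_hom_id := by
    classical
    ext a b <;> simp [biproduct.ι_π]

lemma biproduct_hom_eq_sum {ι : Type} [Fintype ι] [HasFiniteBiproducts C] (f : ι → C) {M : C}
    (p : (⨁ f) ⟶ M) : p = ∑ a, biproduct.π f a ≫ biproduct.ι f a ≫ p := by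
  simp_rw [← Category.assoc]
  rw [← Preadditive.sum_comp, biproduct.total, Category.id_comp]

lemma isZero_biproduct_of_isEmpty {ι : Type} [IsEmpty ι] [HasFiniteBiproducts C] (f : ι → C) :
    IsZero (⨁ f) := by
  rw [IsZero.iff_id_eq_zero]
  exact biproduct.hom_ext _ _ fun a => isEmptyElim a

lemma CohMod.of_iso {M N : C} (e : M ≅ N) (h : CohMod 𝓕 M) : CohMod 𝓕 N :=
  h.of_subobject e.inv (h.1.of_epi e.hom)

lemma CohMod.of_isZero {Z M : C} (hZ : 𝓕 Z) (hM : IsZero M) : CohMod 𝓕 M := by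
  refine ⟨⟨Z, hZ, 0, ⟨fun _ _ _ => hM.eq_of_src _ _⟩⟩, fun F hF f => ?_⟩
  obtain rfl := hM.eq_of_tgt f 0
  exact FinGen.of_epi kernelZeroIsoSource.inv ⟨F, hF, 𝟙 _, inferInstance⟩

lemma cohMod_biproduct (h𝓕 : ∀ F G, 𝓕 F → 𝓕 G → 𝓕 (F ⊞ G)) (h0 : 𝓕 0) [HasFiniteBiproducts C]
    (ι : Type) [Finite ι] (f : ι → C) (hf : ∀ a, CohMod 𝓕 (f a)) : CohMod 𝓕 (⨁ f) := by
  suffices h : ∀ [Finite ι] (f : ι → C) (_ : ∀ a, CohMod 𝓕 (f a)), CohMod 𝓕 (⨁ f) from h f hf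
  refine Finite.induction_empty_option (P := fun ι : Type =>
    ∀ [Finite ι] (f : ι → C) (_ : ∀ a, CohMod 𝓕 (f a)), CohMod 𝓕 (⨁ f)) ?_ ?_ ?_ ι
  · intro α β e h _ f hf
    have : Finite α := Finite.of_equiv _ e.symm
    exact (h (fun a => f (e a)) fun a => hf _).of_iso
      (biproduct.whiskerEquiv (f := fun a => f (e a)) (g := f) e fun a => Iso.refl _)
  · intro _ f hf
    exact CohMod.of_isZero h0 (isZero_biproduct_of_isEmpty f)
  · intro α _ h _ f hf
    let s : α ⊕ Unit → C := fun a => f ((Equiv.optionEquivSumPUnit α).symm a)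
    have hs : CohMod 𝓕 (⨁ s) :=
      ((h (fun a => s (.inl a)) fun a => hf _).biprod h𝓕
        (CohMod.of_iso (biproductUniqueIso fun a => s (.inr a)).symm (hf _))).of_iso
        (biproductSum s).symm
    exact hs.of_iso (biproduct.whiskerEquiv (f := s) (g := f)
      (Equiv.optionEquivSumPUnit α).symm fun a => Iso.refl _)

lemma CohMod.finPres {M : C} (hM : CohMod 𝓕 M) : FinPres 𝓕 M := by
  obtain ⟨F, hF, p, hp⟩ := hM.1
  obtain ⟨F', hF', q, hq⟩ := hM.2 F hF p
  refine ⟨F', F, hF', hF, q ≫ kernel.ι p, p, by simp, ?_, hp⟩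
  rw [ShortComplex.exact_iff_exact_up_to_refinements]
  intro Z z hz
  obtain ⟨Z', e, he, t, ht⟩ := surjective_up_to_refinements_of_epi q (kernel.lift p z hz)
  exact ⟨Z', e, he, t, by simpa using ht =≫ kernel.ι p⟩

lemma FinPres.cohMod
    (h𝓕 : ∀ F G, 𝓕 F → 𝓕 G → 𝓕 (F ⊞ G))
    (hproj : ∀ F, 𝓕 F → Projective F) (hcoh : 𝓕 ≤ CohMod 𝓕) {M : C} (hM : FinPres 𝓕 M) : CohMod 𝓕 M := by
  obtain ⟨F', F, hF', hF, f, g, w, hex, hg⟩ := hM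
  refine ⟨⟨F, hF, g, hg⟩, fun G hG k => ?_⟩
  have := hproj _ hG
  let l : G ⟶ F := Projective.factorThru k g
  have hl : l ≫ g = k := Projective.factorThru_comp _ _
  refine finGen_kernel_of_refine k
    ((hcoh _ hF).2 (G ⊞ F') (h𝓕 _ _ hG hF') (biprod.desc l (-f)))
    (kernel.ι _ ≫ biprod.fst) ?_ fun Z z hz => ?_
  · have h := kernel.condition (biprod.desc l (-f)) =≫ g
    rw [Category.assoc, show biprod.desc l (-f) ≫ g = biprod.fst ≫ k by
      ext <;> simp [hl, w]] at h
    simpa using h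
  · obtain ⟨Z', e, he, t, ht⟩ := hex.exact_up_to_refinements (z ≫ l) (by simp [hl, hz])
    have ht' : e ≫ z ≫ l = t ≫ f := by simpa using ht
    exact ⟨Z', e, he, kernel.lift _ (biprod.lift (e ≫ z) t) (by simp [ht']), by simp⟩

lemma FinPres.kernel
    (h𝓕 : ∀ F G, 𝓕 F → 𝓕 G → 𝓕 (F ⊞ G))
    (hproj : ∀ F, 𝓕 F → Projective F) (hcoh : 𝓕 ≤ CohMod 𝓕) {M N : C} (f : M ⟶ N) (hM : FinPres 𝓕 M)
    (hN : FinPres 𝓕 N) : FinPres 𝓕 (Limits.kernel f) := by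
  have hM' := hM.cohMod h𝓕 hproj hcoh
  have hN' := hN.cohMod h𝓕 hproj hcoh
  obtain ⟨F, hF, p, hp⟩ := hM'.1
  refine (hM'.of_subobject (kernel.ι f) ?_).finPres
  refine finGen_kernel_of_refine f (hN'.2 F hF (p ≫ f)) (kernel.ι _ ≫ p) (by simp)
    fun Z z hz => ?_
  obtain ⟨Z', e, he, t, ht⟩ := surjective_up_to_refinements_of_epi p z
  exact ⟨Z', e, he, kernel.lift _ t (by rw [← reassoc_of% ht, hz, comp_zero]), by simpa using ht⟩

lemma FinPres.cokernel
    (h𝓕 : ∀ F G, 𝓕 F → 𝓕 G → 𝓕 (F ⊞ G))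
    (hproj : ∀ F, 𝓕 F → Projective F) {M N : C} (f : M ⟶ N) (hM : FinPres 𝓕 M)
    (hN : FinPres 𝓕 N) : FinPres 𝓕 (Limits.cokernel f) := by
  obtain ⟨F, G, hF, hG, a, g, w, hex, hg⟩ := hN
  obtain ⟨-, H, -, hH, -, p, -, -, hp⟩ := hM
  have := hproj _ hH
  let l : H ⟶ G := Projective.factorThru (p ≫ f) g
  have hl : l ≫ g = p ≫ f := Projective.factorThru_comp _ _
  have hw : biprod.desc l a ≫ g ≫ cokernel.π f = 0 := by
    ext
    · simp [reassoc_of% hl]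
    · simp [reassoc_of% w]
  refine ⟨H ⊞ F, G, h𝓕 _ _ hH hF, hG, biprod.desc l a, g ≫ cokernel.π f, hw, ?_, epi_comp _ _⟩
  rw [ShortComplex.exact_iff_exact_up_to_refinements]
  intro Z z hz
  dsimp at z hz ⊢
  obtain ⟨Z₁, e₁, he₁, t₁, ht₁⟩ :=
    (ShortComplex.exact_cokernel f).exact_up_to_refinements (z ≫ g) (by simpa using hz)
  obtain ⟨Z₂, e₂, he₂, t₂, ht₂⟩ := surjective_up_to_refinements_of_epi p t₁
  dsimp at ht₁
  obtain ⟨Z₃, e₃, he₃, t₃, ht₃⟩ := hex.exact_up_to_refinements (e₂ ≫ e₁ ≫ z - t₂ ≫ l) (by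
    simp [hl, ← reassoc_of% ht₂, ht₁])
  dsimp at ht₃
  refine ⟨Z₃, e₃ ≫ e₂ ≫ e₁, epi_comp _ _, biprod.lift (e₃ ≫ t₂) t₃, ?_⟩
  simp [← ht₃]

lemma FinPres.biprod
    (h𝓕 : ∀ F G, 𝓕 F → 𝓕 G → 𝓕 (F ⊞ G)) {M N : C} (hM : FinPres 𝓕 M) (hN : FinPres 𝓕 N) : FinPres 𝓕 (M ⊞ N) := by
  obtain ⟨F', F, hF', hF, f, g, w, hex, hg⟩ := hM
  obtain ⟨G', G, hG', hG, f', g', w', hex', hg'⟩ := hN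
  refine ⟨F' ⊞ G', F ⊞ G, h𝓕 _ _ hF' hG', h𝓕 _ _ hF hG, biprod.map f f', biprod.map g g',
    by ext <;> simp [w, w'], ?_, inferInstance⟩
  rw [ShortComplex.exact_iff_exact_up_to_refinements]
  intro Z z hz
  dsimp at z hz ⊢
  obtain ⟨Z₁, e₁, he₁, t₁, ht₁⟩ := hex.exact_up_to_refinements (z ≫ biprod.fst)
    (by simpa using hz =≫ biprod.fst)
  obtain ⟨Z₂, e₂, he₂, t₂, ht₂⟩ := hex'.exact_up_to_refinements (e₁ ≫ z ≫ biprod.snd)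
    (by simpa using e₁ ≫= (hz =≫ biprod.snd))
  dsimp at ht₁ ht₂
  refine ⟨Z₂, e₂ ≫ e₁, epi_comp _ _, biprod.lift (e₂ ≫ t₁) t₂, ?_⟩
  ext
  · simp [ht₁]
  · simp [ht₂]

end Abstract

section AdditiveFunctors

variable {B : Type u} [Category.{u} B] [Preadditive B] {J : Type*} [Category* J]

instance isClosedUnderLimits_additiveFunctor [HasLimitsOfShape J AddCommGrpCat.{u}] :
    (additiveFunctor B AddCommGrpCat.{u}).IsClosedUnderLimitsOfShape J where
  limitsOfShape_le := by
    rintro X ⟨h⟩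
    refine ⟨fun {Y Z f g} => ?_⟩
    refine (isLimitOfPreserves ((evaluation _ _).obj Z) h.isLimit).hom_ext fun j => ?_
    have hj : (h.diag.obj j).Additive := h.prop_diag_obj j
    have e := fun k : Y ⟶ Z => (h.π.app j).naturality k
    simp only [Functor.const_obj_obj] at e
    simp [Preadditive.add_comp, e, Functor.map_add, Preadditive.comp_add]

instance isClosedUnderColimits_additiveFunctor [HasColimitsOfShape J AddCommGrpCat.{u}] :
    (additiveFunctor B AddCommGrpCat.{u}).IsClosedUnderColimitsOfShape J where
  colimitsOfShape_le := by
    rintro X ⟨h⟩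
    refine ⟨fun {Y Z f g} => ?_⟩
    refine (isColimitOfPreserves ((evaluation _ _).obj Y) h.isColimit).hom_ext fun j => ?_
    have hj : (h.diag.obj j).Additive := h.prop_diag_obj j
    have e := fun k : Y ⟶ Z => (h.ι.app j).naturality k
    simp only [Functor.const_obj_obj] at e
    dsimp
    rw [Preadditive.comp_add, ← e, ← e, ← e, Functor.map_add, Preadditive.add_comp]

instance : (additiveFunctor B AddCommGrpCat.{u}).ContainsZero where
  exists_zero := ⟨0, isZero_zero _, ⟨fun {Y _ _ _} =>
    ((evaluation B AddCommGrpCat.{u}).obj Y).map_isZero (isZero_zero _) |>.eq_of_src _ _⟩⟩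

instance : (additiveFunctor B AddCommGrpCat.{u}).IsClosedUnderKernels where
  kernels_le := by
    rintro _ ⟨f, k, hk, hf⟩
    exact ObjectProperty.prop_of_isLimit _ hk (by rintro (_ | _); exacts [hf.1, hf.2])

instance : (additiveFunctor B AddCommGrpCat.{u}).IsClosedUnderCokernels where
  cokernels_le := by
    rintro _ ⟨f, k, hk, hf⟩
    exact ObjectProperty.prop_of_isColimit _ hk (by rintro (_ | _); exacts [hf.1, hf.2])

instance : (additiveFunctor B AddCommGrpCat.{u}).IsClosedUnderFiniteProducts where

/-- Evaluation of additive functors at an object. -/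
abbrev evalAt (b : B) : (B ⥤+ AddCommGrpCat.{u}) ⥤ AddCommGrpCat.{u} :=
  AdditiveFunctor.forget _ _ ⋙ (evaluation _ _).obj b

instance : PreservesColimitsOfSize.{u, u} (AdditiveFunctor.forget B AddCommGrpCat.{u}) :=
  ⟨fun {_} _ => inferInstance⟩

instance : PreservesFiniteLimits (AdditiveFunctor.forget B AddCommGrpCat.{u}) :=
  ⟨fun _ _ _ => inferInstance⟩

instance : PreservesFiniteColimits (AdditiveFunctor.forget B AddCommGrpCat.{u}) :=
  ⟨fun _ _ _ => inferInstance⟩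

lemma surjective_of_epi {M N : B ⥤+ AddCommGrpCat.{u}} (f : M ⟶ N) [Epi f] (b : B) :
    Function.Surjective (f.hom.app b) :=
  (AddCommGrpCat.epi_iff_surjective ((evalAt b).map f)).1 inferInstance

lemma injective_of_mono {M N : B ⥤+ AddCommGrpCat.{u}} (f : M ⟶ N) [Mono f] (b : B) :
    Function.Injective (f.hom.app b) :=
  (AddCommGrpCat.mono_iff_injective ((evalAt b).map f)).1 inferInstance

lemma exact_at {S : ShortComplex (B ⥤+ AddCommGrpCat.{u})} (hS : S.Exact) (b : B)
    (x : S.X₂.obj.obj b) (hx : S.g.hom.app b x = 0) : ∃ y, S.f.hom.app b y = x :=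
  (ShortComplex.ab_exact_iff _).1 (hS.map (evalAt b)) x hx

lemma naturality_apply {M N : B ⥤+ AddCommGrpCat.{u}} (f : M ⟶ N) {b c : B} (a : b ⟶ c)
    (x : M.obj.obj b) : f.hom.app c (M.obj.map a x) = N.obj.map a (f.hom.app b x) :=
  ConcreteCategory.congr_hom (f.hom.naturality a) x

lemma map_add_apply (M : B ⥤+ AddCommGrpCat.{u}) {b c : B} (f g : b ⟶ c) (x : M.obj.obj b) :
    M.obj.map (f + g) x = M.obj.map f x + M.obj.map g x := by
  rw [Functor.map_add]; rfl

lemma map_comp_apply (M : B ⥤+ AddCommGrpCat.{u}) {b c d : B} (f : b ⟶ c) (g : c ⟶ d)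
    (x : M.obj.obj b) : M.obj.map (f ≫ g) x = M.obj.map g (M.obj.map f x) := by
  rw [Functor.map_comp]; rfl

lemma sum_map_apply (M : B ⥤+ AddCommGrpCat.{u}) {b c : B} {ι : Type} [Fintype ι]
    (f : ι → (b ⟶ c)) (x : M.obj.obj b) :
    M.obj.map (∑ i, f i) x = ∑ i, M.obj.map (f i) x :=
  map_sum (AddMonoidHom.mk' (fun a : b ⟶ c => M.obj.map a x)
    fun f g => map_add_apply M f g x) f Finset.univ

lemma sum_hom_app {M N : B ⥤+ AddCommGrpCat.{u}} {ι : Type} [Fintype ι] (f : ι → (M ⟶ N))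
    (b : B) (x : M.obj.obj b) :
    (∑ i, f i).hom.app b x = ∑ i, (f i).hom.app b x :=
  map_sum (AddMonoidHom.mk' (fun a : M ⟶ N => a.hom.app b x) fun _ _ => rfl) f Finset.univ

/-- The subfunctor of an additive functor given by a family of subgroups stable under the
action. -/
def sub (M : B ⥤+ AddCommGrpCat.{u}) (N : ∀ b, AddSubgroup (M.obj.obj b))
    (hN : ∀ ⦃b c : B⦄ (a : b ⟶ c), ∀ x ∈ N b, M.obj.map a x ∈ N c) : B ⥤+ AddCommGrpCat.{u} where
  obj :=
    { obj := fun b => AddCommGrpCat.of (N b)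
      map := fun {b c} a => AddCommGrpCat.ofHom
        (((M.obj.map a).hom.comp (N b).subtype).codRestrict (N c) fun x => hN a x x.2)
      map_id := fun b => by ext x; simp
      map_comp := fun f g => by ext x; simp; rfl }
  property := ⟨fun {b c f g} => by ext x; simp [Functor.map_add]; rfl⟩

/-- The inclusion of a subfunctor. -/
def subι (M : B ⥤+ AddCommGrpCat.{u}) (N : ∀ b, AddSubgroup (M.obj.obj b))
    (hN : ∀ ⦃b c : B⦄ (a : b ⟶ c), ∀ x ∈ N b, M.obj.map a x ∈ N c) : sub M N hN ⟶ M :=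
  ObjectProperty.homMk { app := fun b => AddCommGrpCat.ofHom (N b).subtype }

/-- The inclusion between two subfunctors. -/
def subHom (M : B ⥤+ AddCommGrpCat.{u}) (N N' : ∀ b, AddSubgroup (M.obj.obj b))
    (hN : ∀ ⦃b c : B⦄ (a : b ⟶ c), ∀ x ∈ N b, M.obj.map a x ∈ N c)
    (hN' : ∀ ⦃b c : B⦄ (a : b ⟶ c), ∀ x ∈ N' b, M.obj.map a x ∈ N' c)
    (h : ∀ b, N b ≤ N' b) : sub M N hN ⟶ sub M N' hN' :=
  ObjectProperty.homMk { app := fun b => AddCommGrpCat.ofHom (AddSubgroup.inclusion (h b)) }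

/-- The additive functor `b' ↦ Hom(b, b')`. -/
def corep (b : B) : B ⥤+ AddCommGrpCat.{u} :=
  AdditiveFunctor.of (preadditiveCoyoneda.obj (Opposite.op b))

/-- The morphism out of `corep b` given by an element. -/
def corepHom {M : B ⥤+ AddCommGrpCat.{u}} {b : B} (x : M.obj.obj b) : corep b ⟶ M :=
  ObjectProperty.homMk
    { app := fun c => AddCommGrpCat.ofHom (AddMonoidHom.mk' (fun a : b ⟶ c => M.obj.map a x)
        fun f g => map_add_apply M f g x)
      naturality := fun c d f => by
        ext a
        exact map_comp_apply M _ _ x }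

lemma corep_hom_apply {M : B ⥤+ AddCommGrpCat.{u}} {b c : B} (f : corep b ⟶ M) (a : b ⟶ c) :
    f.hom.app c a = M.obj.map a (f.hom.app b (𝟙 b)) := by
  refine Eq.trans ?_ (naturality_apply f a (𝟙 b))
  exact congrArg (f.hom.app c) (Category.id_comp a).symm

lemma corep_hom_ext {M : B ⥤+ AddCommGrpCat.{u}} {b : B} {f g : corep b ⟶ M}
    (h : f.hom.app b (𝟙 b) = g.hom.app b (𝟙 b)) : f = g := by
  ext c a
  exact (corep_hom_apply f a).trans ((congrArg _ h).trans (corep_hom_apply g a).symm)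

instance (b : B) : Projective (corep b) where
  factors {M N} f e he := by
    obtain ⟨x, hx⟩ := surjective_of_epi e b (f.hom.app b (𝟙 b))
    refine ⟨corepHom x, corep_hom_ext ?_⟩
    change e.hom.app b (M.obj.map (𝟙 b) x) = _
    simpa using hx

end AdditiveFunctors

/-- An `I`-indexed algebra `A = ⨁ A_{ij}`, i.e. a preadditive category whose objects are indexed by
`I`: abelian groups `A_{ij}`, units `e_i ∈ A_{ii}` and biadditive associative unital
multiplications `A_{ij} × A_{jl} → A_{il}`. -/
structure IndexedAlgebra (I : Type u) where
  /-- The homogeneous component `A_{ij}`. -/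
  comp : I → I → Type u
  [grp : ∀ i j, AddCommGroup (comp i j)]
  /-- The local unit `e_i`. -/
  unit : ∀ i, comp i i
  /-- The multiplication. -/
  mul : ∀ {i j l}, comp i j → comp j l → comp i l
  unit_mul : ∀ {i j} (a : comp i j), mul (unit i) a = a
  mul_unit : ∀ {i j} (a : comp i j), mul a (unit j) = a
  mul_assoc : ∀ {i j l m} (a : comp i j) (b : comp j l) (c : comp l m),
    mul (mul a b) c = mul a (mul b c)
  add_mul : ∀ {i j l} (a b : comp i j) (c : comp j l), mul (a + b) c = mul a c + mul b c
  mul_add : ∀ {i j l} (a : comp i j) (b c : comp j l), mul a (b + c) = mul a b + mul a c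

namespace IndexedAlgebra

attribute [instance] IndexedAlgebra.grp

variable {I : Type u} (A : IndexedAlgebra I)

/-- The objects of the preadditive category attached to `A`: a copy of the index set. -/
structure Ob (A : IndexedAlgebra I) where
  /-- The index of an object. -/
  idx : I

instance : Category.{u} A.Ob where
  Hom X Y := A.comp X.idx Y.idx
  id X := A.unit X.idx
  comp f g := A.mul f g
  id_comp := A.unit_mul
  comp_id := A.mul_unit
  assoc := A.mul_assoc

instance : Preadditive A.Ob where
  homGroup X Y := A.grp X.idx Y.idx
  add_comp _ _ _ := A.add_mul
  comp_add _ _ _ := A.mul_add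

/-- `Gr A`: the category of right `A`-modules, i.e. of families of abelian groups `M_i` with
actions `M_i × A_{ij} → M_j`. As `A_{ij}` is the group of morphisms `i ⟶ j` in `A.Ob`, these are
the covariant additive functors from `A.Ob` to abelian groups. -/
abbrev Gr : Type (u + 1) := A.Ob ⥤+ AddCommGrpCat.{u}

variable {A} in
/-- The degree `i` component `M_i` of a module. -/
abbrev Gr.deg (M : A.Gr) (i : I) : AddCommGrpCat.{u} := M.obj.obj ⟨i⟩

instance : HasFiniteBiproducts A.Gr := Abelian.hasFiniteBiproducts

/-- The right module `P_i = e_i A`, with `(P_i)_j = A_{ij}`. -/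
def P (i : I) : A.Gr := corep (⟨i⟩ : A.Ob)

/-- Finitely generated free modules: finite direct sums of modules `P_i`. -/
def isFree : ObjectProperty A.Gr := fun F =>
  ∃ (ι : Type) (_ : Finite ι) (k : ι → I), Nonempty (F ≅ ⨁ fun a => A.P (k a))

/-- Finitely presented modules. -/
abbrev isFinPres : ObjectProperty A.Gr := FinPres A.isFree

/-- Coherent modules. -/
abbrev isCohMod : ObjectProperty A.Gr := CohMod A.isFree

/-- `A` is connected if every `A_{ii}` is a division ring. -/
class Connected : Prop where
  unit_ne_zero (i : I) : A.unit i ≠ 0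
  exists_inv (i : I) (a : A.comp i i) (ha : a ≠ 0) :
    ∃ b : A.comp i i, A.mul a b = A.unit i ∧ A.mul b a = A.unit i

/-- `A` is positively indexed if `A_{ij} ≠ 0` only if `i ≤ j`. -/
class PositivelyIndexed [PartialOrder I] : Prop where
  le_of_ne_zero {i j : I} (a : A.comp i j) (ha : a ≠ 0) : i ≤ j

/-- `A` is (right) coherent if the modules `P_i` are all coherent. -/
class Coherent : Prop where
  coherent_P (i : I) : A.isCohMod (A.P i)

lemma isFree_P (i : I) : A.isFree (A.P i) :=
  ⟨Unit, inferInstance, fun _ => i, ⟨(biproductUniqueIso fun _ : Unit => A.P i).symm⟩⟩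

lemma isFree_zero : A.isFree 0 :=
  ⟨PEmpty, inferInstance, PEmpty.elim, ⟨(isZero_zero _).iso (isZero_biproduct_of_isEmpty _)⟩⟩

lemma projective_of_isFree (F : A.Gr) (hF : A.isFree F) : Projective F := by
  obtain ⟨ι, _, k, ⟨e⟩⟩ := hF
  have : ∀ a, Projective (A.P (k a)) := fun a => inferInstanceAs (Projective (corep _))
  have h : Projective (⨁ fun a => A.P (k a)) := ⟨fun {E X} f g hg => by
    refine ⟨biproduct.desc fun a => Projective.factorThru
      (biproduct.ι (fun a => A.P (k a)) a ≫ f) g, ?_⟩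
    exact biproduct.hom_ext' _ _ fun a => by simp⟩
  exact Projective.of_iso e.symm h

lemma isFree_biprod (F G : A.Gr) (hF : A.isFree F) (hG : A.isFree G) : A.isFree (F ⊞ G) := by
  obtain ⟨ι, _, k, ⟨e⟩⟩ := hF
  obtain ⟨κ, _, l, ⟨e'⟩⟩ := hG
  exact ⟨ι ⊕ κ, inferInstance, Sum.elim k l,
    ⟨biprod.mapIso e e' ≪≫ (biproductSum fun a => A.P (Sum.elim k l a)).symm⟩⟩

lemma isFree_le_isCohMod [A.Coherent] : A.isFree ≤ A.isCohMod := by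
  rintro F ⟨ι, _, k, ⟨e⟩⟩
  have key := cohMod_biproduct A.isFree_biprod A.isFree_zero ι (fun a => A.P (k a))
    fun a => Coherent.coherent_P (k a)
  exact key.of_iso e.symm

lemma isFinPres_of_isFree (F : A.Gr) (hF : A.isFree F) : A.isFinPres F :=
  ⟨0, F, A.isFree_zero, hF, 0, 𝟙 _, by simp, (ShortComplex.exact_iff_mono _ rfl).2
    (by dsimp; infer_instance), inferInstance⟩

instance : A.isFinPres.ContainsZero where
  exists_zero := ⟨0, isZero_zero _, A.isFinPres_of_isFree _ A.isFree_zero⟩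

instance : A.isFinPres.IsClosedUnderIsomorphisms where
  of_iso := by
    rintro M N e ⟨F', F, hF', hF, f, g, w, hex, hg⟩
    have w' : f ≫ g ≫ e.hom = 0 := by rw [reassoc_of% w, zero_comp]
    let e' : ShortComplex.mk f g w ≅ ShortComplex.mk f (g ≫ e.hom) w' :=
      ShortComplex.isoMk (Iso.refl _) (Iso.refl _) e
    exact ⟨F', F, hF', hF, f, g ≫ e.hom, w', (ShortComplex.exact_iff_of_iso e').1 hex,
      epi_comp _ _⟩

instance : A.isFinPres.IsClosedUnderBinaryProducts where
  limitsOfShape_le := by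
    rintro X ⟨h⟩
    have e : X ≅ h.diag.obj ⟨.left⟩ ⊞ h.diag.obj ⟨.right⟩ :=
      h.isLimit.conePointUniqueUpToIso (limit.isLimit _) ≪≫
        HasLimit.isoOfNatIso (diagramIsoPair _) ≪≫ (biprod.isoProd _ _).symm
    exact A.isFinPres.prop_of_iso e.symm
      ((h.prop_diag_obj _).biprod A.isFree_biprod (h.prop_diag_obj _))

instance : A.isFinPres.IsClosedUnderFiniteProducts :=
  ObjectProperty.IsClosedUnderFiniteProducts.mk'

instance : A.isFinPres.IsClosedUnderCokernels where
  cokernels_le := by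
    rintro _ ⟨f, k, hk, hf⟩
    exact A.isFinPres.prop_of_iso ((cokernelIsCokernel f).coconePointUniqueUpToIso hk)
      (FinPres.cokernel A.isFree_biprod A.projective_of_isFree f hf.1 hf.2)

instance [A.Coherent] : A.isFinPres.IsClosedUnderKernels where
  kernels_le := by
    rintro _ ⟨f, k, hk, hf⟩
    exact A.isFinPres.prop_of_iso ((kernelIsKernel f).conePointUniqueUpToIso hk)
      (FinPres.kernel A.isFree_biprod A.projective_of_isFree A.isFree_le_isCohMod f hf.1 hf.2)

/-- `gr A`: the category of finitely presented right modules. -/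
abbrev gr : Type (u + 1) := A.isFinPres.FullSubcategory

/-- The inclusion of `gr A` in `Gr A`. -/
abbrev ι : A.gr ⥤ A.Gr := A.isFinPres.ι

instance [A.Coherent] : PreservesFiniteLimits A.ι := by
  rw [((Functor.preservesFiniteLimits_tfae A.ι).out 3 2 :)]
  intro _ _ f
  exact A.isFinPres.preservesKernels_ι f

instance [A.Coherent] : PreservesFiniteColimits A.ι := by
  rw [((Functor.preservesFiniteColimits_tfae A.ι).out 3 2 :)]
  intro _ _ f
  exact A.isFinPres.preservesCokernels_ι f

section Tails

variable [PartialOrder I]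

section

variable [A.PositivelyIndexed]

variable {A} in
/-- The components of the tail `M_{> d}`: all of `M_j` if `d < j`, and zero otherwise. -/
def tailSubgroup (M : A.Gr) (d : I) (X : A.Ob) : AddSubgroup (M.obj.obj X) where
  carrier := {m | ¬ d < X.idx → m = 0}
  zero_mem' _ := rfl
  add_mem' {a b} ha hb h := by rw [ha h, hb h, add_zero]
  neg_mem' {a} ha h := by rw [ha h, neg_zero]

variable {A} in
lemma tailSubgroup_map (M : A.Gr) (d : I) ⦃X Y : A.Ob⦄ (a : X ⟶ Y) (m : M.obj.obj X)
    (hm : m ∈ tailSubgroup M d X) : M.obj.map a m ∈ tailSubgroup M d Y := by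
  intro hY
  by_cases hX : d < X.idx
  · have ha : a = 0 := by
      by_contra h
      exact hY (lt_of_lt_of_le hX (PositivelyIndexed.le_of_ne_zero (A := A) a h))
    rw [ha, Functor.map_zero]; rfl
  · rw [hm hX, map_zero]

variable {A} in
/-- The (strict) tail `M_{> d}`, the submodule of `M` with components `M_j` for `j > d`. -/
def tail (M : A.Gr) (d : I) : A.Gr := sub M (tailSubgroup M d) (tailSubgroup_map M d)

variable {A} in
/-- The inclusion `M_{> d} ⟶ M`. -/
def tailι (M : A.Gr) (d : I) : tail M d ⟶ M := subι M (tailSubgroup M d) (tailSubgroup_map M d)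

/-- `A` is (right) tails-cocompact if `P_i / P_{i, > d}` is finitely presented for all `i ≤ d`. -/
class TailsCocompact : Prop where
  isFinPres_quotient (i d : I) (h : i ≤ d) : A.isFinPres (cokernel (tailι (A.P i) d))

end

/-- A module is upper-bounded if `M_{> d} = 0` for some `d`. -/
def isUpperBounded : ObjectProperty A.Gr := fun M => ∃ d : I, ∀ j, d < j → ∀ m : M.deg j, m = 0

end Tails
end IndexedAlgebra

/-- The objects which are colimits of diagrams of objects satisfying `P` indexed by (small,
nonempty) directed partially ordered sets. -/
def directedColimits {C : Type*} [Category* C] (P : ObjectProperty C) : ObjectProperty C :=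
  fun X => ∃ (J : Type u) (_ : PartialOrder J) (_ : IsDirectedOrder J) (_ : Nonempty J),
    P.colimitsOfShape J X

namespace IndexedAlgebra
variable {I : Type u} (A : IndexedAlgebra I) [PartialOrder I]

/-- `Tors A`: a module is torsion if it is a directed colimit of upper-bounded modules. -/
def Tors : ObjectProperty A.Gr := directedColimits.{u} A.isUpperBounded

section
variable {A}

/-- The elements `m` with `(mA)_{> d} = 0`. -/
def torsSubgroup (M : A.Gr) (d : I) (X : A.Ob) : AddSubgroup (M.obj.obj X) where
  carrier := {m | ∀ (Y : A.Ob) (a : X ⟶ Y), d < Y.idx → M.obj.map a m = 0}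
  zero_mem' _ _ _ := map_zero _
  add_mem' {a b} ha hb Y f h := by rw [map_add, ha Y f h, hb Y f h, add_zero]
  neg_mem' {a} ha Y f h := by rw [map_neg, ha Y f h, neg_zero]

lemma torsSubgroup_map (M : A.Gr) (d : I) ⦃X Y : A.Ob⦄ (a : X ⟶ Y) (m : M.obj.obj X)
    (hm : m ∈ torsSubgroup M d X) : M.obj.map a m ∈ torsSubgroup M d Y := by
  intro Z b hZ
  rw [← map_comp_apply]
  exact hm Z _ hZ

lemma torsSubgroup_mono (M : A.Gr) {d d' : I} (h : d ≤ d') (X : A.Ob) :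
    torsSubgroup M d X ≤ torsSubgroup M d' X :=
  fun _ hm Y a hY => hm Y a (lt_of_le_of_lt h hY)

/-- The filtration of a module by its submodules of torsion elements with given bound. -/
def torsDiag (M : A.Gr) : I ⥤ A.Gr where
  obj d := sub M (torsSubgroup M d) (torsSubgroup_map M d)
  map f := subHom M _ _ _ _ (torsSubgroup_mono M (leOfHom f))
  map_id _ := rfl
  map_comp _ _ := rfl

/-- The canonical cocone over `torsDiag`. -/
def torsCocone (M : A.Gr) : Cocone (torsDiag M) where
  pt := M
  ι := { app := fun d => subι M (torsSubgroup M d) (torsSubgroup_map M d)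
         naturality := fun _ _ _ => rfl }

/-- If every element is torsion, the module is the union of the submodules `torsDiag`. -/
noncomputable def torsIsColimit [IsDirectedOrder I] [Nonempty I] (M : A.Gr)
    (h : ∀ (X : A.Ob) (m : M.obj.obj X), ∃ d, m ∈ torsSubgroup M d X) :
    IsColimit (torsCocone M) := by
  have : PreservesColimitsOfShape I (forget AddCommGrpCat.{u}) := inferInstance
  have : ReflectsColimitsOfShape I (forget AddCommGrpCat.{u}) :=
    reflectsColimitsOfShape_of_reflectsIsomorphisms
  refine isColimitOfReflects (AdditiveFunctor.forget _ _) (evaluationJointlyReflectsColimits _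
    fun X => isColimitOfReflects (forget AddCommGrpCat.{u}) ?_)
  refine Types.FilteredColimit.isColimitOf' _ _ (fun m => ?_) fun d m m' hm => ?_
  · obtain ⟨d, hd⟩ := h X m
    exact ⟨d, ⟨m, hd⟩, rfl⟩
  · exact ⟨d, 𝟙 _, congrArg _ (Subtype.ext hm)⟩

lemma Tors_iff [IsDirectedOrder I] [Nonempty I] (M : A.Gr) :
    A.Tors M ↔ ∀ (X : A.Ob) (m : M.obj.obj X), ∃ d, m ∈ torsSubgroup M d X := by
  constructor
  · rintro ⟨J, _, _, _, ⟨h⟩⟩ X m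
    obtain ⟨j, y, hy⟩ := Concrete.isColimit_exists_rep _
      (isColimitOfPreserves (evalAt X) h.isColimit) m
    obtain ⟨d, hd⟩ := h.prop_diag_obj j
    refine ⟨d, fun Y a hY => ?_⟩
    have e := naturality_apply (h.ι.app j) a y
    have : (h.diag.obj j).obj.map a y = 0 := hd Y.idx hY _
    rw [this, map_zero] at e
    rw [← hy]
    exact e.symm
  · intro h
    refine ⟨I, inferInstance, inferInstance, inferInstance, ⟨⟨⟨torsDiag M, (torsCocone M).ι,
      torsIsColimit M h⟩, fun d => ⟨d, fun j hj m => ?_⟩⟩⟩⟩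
    have h1 : M.obj.map (𝟙 (⟨j⟩ : A.Ob)) m.1 = 0 := m.2 ⟨j⟩ (𝟙 _) hj
    exact Subtype.ext ((ConcreteCategory.congr_hom (M.obj.map_id _) m.1).symm.trans h1)

end

variable [IsDirectedOrder I] [Nonempty I]

instance : A.Tors.ContainsZero where
  exists_zero := ⟨0, isZero_zero _, (Tors_iff _).2 fun X m => by
    have : IsZero ((evalAt X).obj (0 : A.Gr)) := (evalAt X).map_isZero (isZero_zero _)
    have hm : m = 0 := by
      have := ConcreteCategory.congr_hom (IsZero.iff_id_eq_zero _ |>.1 this) m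
      exact this
    subst hm
    exact ⟨Classical.arbitrary I, zero_mem _⟩⟩

instance : A.Tors.IsClosedUnderSubobjects where
  prop_of_mono {M N} f _ hN := (Tors_iff _).2 fun X m => by
    obtain ⟨d, hd⟩ := (Tors_iff _).1 hN X (f.hom.app X m)
    refine ⟨d, fun Y a hY => injective_of_mono f Y ?_⟩
    rw [naturality_apply, hd Y a hY, map_zero]

instance : A.Tors.IsClosedUnderQuotients where
  prop_of_epi {M N} f _ hM := (Tors_iff _).2 fun X n => by
    obtain ⟨m, rfl⟩ := surjective_of_epi f X n
    obtain ⟨d, hd⟩ := (Tors_iff _).1 hM X m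
    refine ⟨d, fun Y a hY => ?_⟩
    rw [← naturality_apply, hd Y a hY, map_zero]

/-- A generating family for a finitely generated module. -/
lemma exists_generators (M : A.Gr) (hM : FinGen A.isFree M) :
    ∃ (ι : Type) (_ : Fintype ι) (k : ι → A.Ob) (x : ∀ a, M.obj.obj (k a)),
      ∀ (Y : A.Ob) (m : M.obj.obj Y), ∃ b : ∀ a, k a ⟶ Y, m = ∑ a, M.obj.map (b a) (x a) := by
  obtain ⟨F, ⟨ι, _, k, ⟨e⟩⟩, p, hp⟩ := hM
  have := Fintype.ofFinite ι
  let q : ∀ a, corep (⟨k a⟩ : A.Ob) ⟶ M := fun a =>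
    biproduct.ι (fun a => A.P (k a)) a ≫ e.inv ≫ p
  refine ⟨ι, inferInstance, fun a => ⟨k a⟩, fun a => (q a).hom.app _ (𝟙 _), fun Y m => ?_⟩
  obtain ⟨z, rfl⟩ := surjective_of_epi (e.inv ≫ p) Y m
  let b : ∀ a, (⟨k a⟩ : A.Ob) ⟶ Y := fun a => (biproduct.π (fun a => A.P (k a)) a).hom.app Y z
  refine ⟨b, ?_⟩
  have hz : e.inv ≫ p = ∑ a, biproduct.π (fun a => A.P (k a)) a ≫ q a :=
    biproduct_hom_eq_sum _ _
  rw [hz, sum_hom_app]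
  exact Finset.sum_congr rfl fun a _ => corep_hom_apply (q a) (b a)

instance (M : A.Gr) [A.PositivelyIndexed] (d : I) : Mono (tailι M d) := by
  refine (AdditiveFunctor.forget _ _).mono_of_mono_map ?_
  have : ∀ X, Mono (((AdditiveFunctor.forget _ _).map (tailι M d)).app X) := fun X =>
    (AddCommGrpCat.mono_iff_injective _).2 Subtype.val_injective
  exact NatTrans.mono_of_mono_app _

/-- For `i ≤ d`, the tail `P_{i, > d}` is finitely generated. -/
lemma finGen_tail [A.PositivelyIndexed] [A.TailsCocompact] {i d : I} (h : i ≤ d) :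
    FinGen A.isFree (tail (A.P i) d) := by
  have hk := FinPres.finGen_kernel A.isFree_biprod A.projective_of_isFree
    (TailsCocompact.isFinPres_quotient i d h) (A.isFree_P i) (cokernel.π (tailι (A.P i) d))
  exact hk.of_epi ((kernelIsKernel _).conePointUniqueUpToIso
    (Abelian.monoIsKernelOfCokernel _ (cokernelIsCokernel (tailι (A.P i) d)))).hom

lemma exists_generators_tail [A.PositivelyIndexed] [A.TailsCocompact] (X : A.Ob) (d : I)
    (h : X.idx ≤ d) :
    ∃ (ι : Type) (_ : Fintype ι) (k : ι → A.Ob) (x : ∀ a, X ⟶ k a),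
      (∀ a, ¬ d < (k a).idx → x a = 0) ∧
      ∀ (Y : A.Ob) (f : X ⟶ Y), d < Y.idx → ∃ b : ∀ a, k a ⟶ Y, f = ∑ a, x a ≫ b a := by
  obtain ⟨ι, _, k, x, hx⟩ := A.exists_generators _ (A.finGen_tail h)
  refine ⟨ι, inferInstance, k, fun a => (x a).1, fun a => (x a).2, fun Y f hY => ?_⟩
  obtain ⟨b, hb⟩ := hx Y ⟨f, fun h => absurd hY h⟩
  refine ⟨b, ?_⟩
  have h2 := congrArg (AddSubgroup.subtype (tailSubgroup (A.P X.idx) d Y)) hb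
  exact h2.trans (map_sum _ _ _)

instance [A.PositivelyIndexed] [A.TailsCocompact] : A.Tors.IsClosedUnderExtensions where
  prop_X₂_of_shortExact {S} hS h₁ h₃ := (Tors_iff _).2 fun X m => by
    have := hS.mono_f
    obtain ⟨d₀, hd₀⟩ := (Tors_iff _).1 h₃ X (S.g.hom.app X m)
    obtain ⟨d, hXd, hd₀d⟩ := exists_ge_ge X.idx d₀
    have hd := torsSubgroup_mono _ hd₀d X hd₀
    obtain ⟨ι, _, k, x, hx, hgen⟩ := A.exists_generators_tail X d hXd
    have key : ∀ a, ∃ u, ∀ (Y : A.Ob) (b : k a ⟶ Y), u < Y.idx →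
        S.X₂.obj.map b (S.X₂.obj.map (x a) m) = 0 := by
      intro a
      by_cases hk : d < (k a).idx
      · obtain ⟨m', hm'⟩ := exact_at hS.exact (k a) (S.X₂.obj.map (x a) m) (by
          rw [naturality_apply, hd _ _ hk])
        obtain ⟨u, hu⟩ := (Tors_iff _).1 h₁ (k a) m'
        refine ⟨u, fun Y b hY => ?_⟩
        rw [← hm', ← naturality_apply, hu Y b hY, map_zero]
      · refine ⟨d, fun Y b hY => ?_⟩
        rw [hx a hk, Functor.map_zero]
        exact map_zero _
    choose u hu using key
    obtain ⟨v, hv⟩ := (Set.finite_range u).bddAbove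
    obtain ⟨w, hvw, hdw⟩ := exists_ge_ge v d
    refine ⟨w, fun Y a hY => ?_⟩
    obtain ⟨b, rfl⟩ := hgen Y a (lt_of_le_of_lt hdw hY)
    rw [sum_map_apply]
    refine Finset.sum_eq_zero fun c _ => ?_
    rw [map_comp_apply]
    exact hu c Y (b c) (lt_of_le_of_lt ((hv ⟨c, rfl⟩).trans hvw) hY)

instance [A.PositivelyIndexed] [A.TailsCocompact] : A.Tors.IsSerreClass where

section Quotients

variable [A.PositivelyIndexed] [A.TailsCocompact]

/-- `QGr A := Gr A / Tors A`, the Serre quotient: the localization of `Gr A` at the morphisms whose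
kernel and cokernel are torsion. -/
abbrev QGr : Type (u + 1) := A.Tors.isoModSerre.Localization

/-- The quotient functor `π : Gr A ⥤ QGr A`. -/
abbrev π : A.Gr ⥤ A.QGr := A.Tors.isoModSerre.Q

noncomputable instance : Abelian A.QGr :=
  ObjectProperty.SerreClassLocalization.abelian A.π A.Tors

end Quotients

/-- `tors A = Tors A ∩ gr A`, as a class of objects of `gr A`. -/
def tors : ObjectProperty A.gr := A.Tors.inverseImage A.ι

section Quotients

variable [A.PositivelyIndexed] [A.TailsCocompact] [A.Coherent]

instance : A.tors.IsSerreClass := inferInstanceAs (A.Tors.inverseImage A.ι).IsSerreClass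

/-- `qgr A := gr A / tors A`, the Serre quotient. -/
abbrev qgr : Type (u + 1) := A.tors.isoModSerre.Localization

/-- The quotient functor `gr A ⥤ qgr A`. -/
abbrev πqgr : A.gr ⥤ A.qgr := A.tors.isoModSerre.Q

noncomputable instance : Abelian A.qgr :=
  ObjectProperty.SerreClassLocalization.abelian A.πqgr A.tors

end Quotients

end IndexedAlgebra

section LocallyCoherent

variable (C : Type*) [Category* C]

/-- An object `X` is finitely generated if, whenever `X` is the supremum of a directed family of
subobjects, it is equal to one of them. -/
def isFinGenObj : ObjectProperty C := fun X => IsCompactElement (⊤ : Subobject X)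

/-- The coherent objects of `C`: the finitely presented objects (those `X` for which `Hom(X, -)`
preserves filtered colimits) all of whose finitely generated subobjects are finitely presented. -/
def coh : ObjectProperty C := fun X =>
  IsFinitelyPresentable.{u} X ∧
    ∀ (Y : C) (i : Y ⟶ X) [Mono i], isFinGenObj C Y → IsFinitelyPresentable.{u} Y

/-- A locally coherent category: a Grothendieck category with a (small) family of coherent
generators. -/
def IsLocallyCoherent [Abelian C] : Prop :=
  IsGrothendieckAbelian.{u} C ∧
    ∃ (ι : Type u) (G : ι → C), (∀ a, coh.{u} C (G a)) ∧ (ObjectProperty.ofObj G).IsSeparating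

end LocallyCoherent

end NCProj

namespace NCProj

open ZeroObject

/-! ### Elements of additive functors, and presentability of corepresentables. -/

section AdditiveFunctors

variable {B : Type u} [Category.{u} B] [Preadditive B]

/-! Everything rests on an elementwise description: `M` is torsion iff for each element `m` some `d`
satisfies `(mA)_{>d} = 0` (`Tors_iff`). Such an `m`, in degree `i` with `d ≥ i`, is the image of the
generator of `P_i / P_{i,>d}`, which is upper-bounded and, by tails-cocompactness, finitely
presented. So every element of a torsion module comes from a finitely presented torsion module, and
the filtered category of these over `M` exhibits `M` as a directed colimit
(`directedColimits_of_exists`).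

The section functor comes from the special adjoint functor theorem. Torsion modules are closed under
colimits, so the quotient functor preserves coproducts, hence all colimits. Hom types out of
finitely presented modules are small because, by coherence and finite generation of tails, every
morphism to such a module that is an isomorphism modulo torsion is dominated by one with finitely
presented source (`exists_isFinPres_of_isoModSerre`).

The modules with invertible unit `M ⟶ ω π M` are those local for the tail inclusions `P_{i,>d} ⟶
P_i`, `i ≤ d` (`isIso_unit_of_isLocal`). Both ends of these are finitely presented, so local modules
are closed under filtered colimits, and `ω` commutes with filtered colimits.

Hence `π` preserves finite presentation. Finitely generated subobjects of `π X` come from finitely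
generated submodules of `X`, so `π X` is coherent for finitely presented `X` (`coh_π`). The induced
functor from `qgr A` is faithful since it reflects zero objects, and full by the domination of
fractions. It reaches every finitely presented `Y`: as `ω Y` is a directed colimit of finitely
presented modules, `Y` is a retract of the image of one of them, and idempotents split in `qgr A`
(`exists_iso_qgrι`). -/

@[simp]
lemma corepHom_app_id {M : B ⥤+ AddCommGrpCat.{u}} {b : B} (x : M.obj.obj b) :
    (corepHom x).hom.app b (𝟙 b) = x :=
  ConcreteCategory.congr_hom (M.obj.map_id b) x

lemma corepHom_comp {M N : B ⥤+ AddCommGrpCat.{u}} {b : B} (x : M.obj.obj b) (f : M ⟶ N) :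
    corepHom x ≫ f = corepHom (f.hom.app b x) :=
  corep_hom_ext (by
    rw [corepHom_app_id]
    exact congrArg (f.hom.app b) (corepHom_app_id x))

lemma comp_app_apply {M N K : B ⥤+ AddCommGrpCat.{u}} (f : M ⟶ N) (g : N ⟶ K) (b : B)
    (x : M.obj.obj b) : (f ≫ g).hom.app b x = g.hom.app b (f.hom.app b x) := rfl

lemma epi_of_surjective {M N : B ⥤+ AddCommGrpCat.{u}} (f : M ⟶ N)
    (h : ∀ b, Function.Surjective (f.hom.app b)) : Epi f := by
  refine (AdditiveFunctor.forget _ _).epi_of_epi_map ?_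
  have : ∀ b, Epi (((AdditiveFunctor.forget _ _).map f).app b) := fun b =>
    (AddCommGrpCat.epi_iff_surjective _).2 (h b)
  exact NatTrans.epi_of_epi_app _

lemma mono_of_injective {M N : B ⥤+ AddCommGrpCat.{u}} (f : M ⟶ N)
    (h : ∀ b, Function.Injective (f.hom.app b)) : Mono f := by
  refine (AdditiveFunctor.forget _ _).mono_of_mono_map ?_
  have : ∀ b, Mono (((AdditiveFunctor.forget _ _).map f).app b) := fun b =>
    (AddCommGrpCat.mono_iff_injective _).2 (h b)
  exact NatTrans.mono_of_mono_app _

lemma exists_of_kernel {M N : B ⥤+ AddCommGrpCat.{u}} (f : M ⟶ N) {b : B} (x : M.obj.obj b)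
    (hx : f.hom.app b x = 0) : ∃ y, (kernel.ι f).hom.app b y = x :=
  exact_at (ShortComplex.exact_kernel f) b x hx

lemma kernel_apply {M N : B ⥤+ AddCommGrpCat.{u}} (f : M ⟶ N) {b : B}
    (y : (kernel f).obj.obj b) : f.hom.app b ((kernel.ι f).hom.app b y) = 0 := by
  rw [← comp_app_apply, kernel.condition]; rfl

lemma exists_of_cokernel {M N : B ⥤+ AddCommGrpCat.{u}} (f : M ⟶ N) {b : B} (x : N.obj.obj b)
    (hx : (cokernel.π f).hom.app b x = 0) : ∃ y, f.hom.app b y = x :=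
  exact_at (ShortComplex.exact_cokernel f) b x hx

lemma cokernel_apply {M N : B ⥤+ AddCommGrpCat.{u}} (f : M ⟶ N) {b : B}
    (y : M.obj.obj b) : (cokernel.π f).hom.app b (f.hom.app b y) = 0 := by
  rw [← comp_app_apply, cokernel.condition]; rfl

section

attribute [local instance] Cardinal.fact_isRegular_aleph0

/-- By Yoneda, `Hom(corep b, -)` is evaluation at `b`, and colimits of additive functors are
computed pointwise. -/
instance (b : B) : IsFinitelyPresentable.{u} (corep b) := by
  rw [isFinitelyPresentable_iff_preservesFilteredColimitsOfSize]
  refine ⟨fun J _ _ => ?_⟩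
  have e : evalAt b ⋙ forget AddCommGrpCat.{u} ≅ coyoneda.obj (Opposite.op (corep b)) :=
    NatIso.ofComponents (fun M => Equiv.toIso
      { toFun := fun x => corepHom x
        invFun := fun f => f.hom.app b (𝟙 b)
        left_inv := fun x => corepHom_app_id x
        right_inv := fun f => corep_hom_ext (corepHom_app_id _) })
      (fun f => by
        ext x
        exact (corepHom_comp x f).symm)
  exact preservesColimitsOfShape_of_natIso e

end

end AdditiveFunctors

/-! ### Finitely presented modules: categorical presentability and essential smallness. -/

namespace IndexedAlgebra

variable {I : Type u} (A : IndexedAlgebra I)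

instance (i : I) : IsFinitelyPresentable.{u} (A.P i) :=
  inferInstanceAs (IsFinitelyPresentable.{u} (corep _))

section

attribute [local instance] Cardinal.fact_isRegular_aleph0

/-- Finitely presentable objects are closed under finite colimits: finite sums of the `P i`, then a
cokernel. -/
lemma isFinitelyPresentable_of_isFinPres {M : A.Gr} (hM : A.isFinPres M) :
    IsFinitelyPresentable.{u} M := by
  have h₁ : ∀ F : A.Gr, A.isFree F → isCardinalPresentable A.Gr Cardinal.aleph0.{u} F := by
    rintro F ⟨ι, _, k, ⟨e⟩⟩
    refine (isCardinalPresentable A.Gr Cardinal.aleph0.{u}).prop_of_iso e.symm ?_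
    have hι : HasCardinalLT (Arrow (Discrete ι)) Cardinal.aleph0.{u} := by
      have : Finite (Arrow (Discrete ι)) :=
        Finite.of_equiv _ (Arrow.discreteEquiv ι).symm
      rwa [hasCardinalLT_aleph0_iff]
    have := isClosedUnderColimitsOfShape_isCardinalPresentable A.Gr hι
    exact ObjectProperty.prop_of_isColimit _ (biproduct.isColimit fun a => A.P (k a))
      fun a => inferInstanceAs (IsFinitelyPresentable.{u} (A.P _))
  obtain ⟨F', F, hF', hF, f, g, w, hex, hg⟩ := hM
  have hJ : HasCardinalLT (Arrow WalkingParallelPair) Cardinal.aleph0.{u} := by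
    rw [hasCardinalLT_aleph0_iff]
    infer_instance
  have := isClosedUnderColimitsOfShape_isCardinalPresentable A.Gr hJ
  exact (isCardinalPresentable A.Gr Cardinal.aleph0.{u}).prop_of_isColimit hex.gIsCokernel
    (by rintro (_ | _); exacts [h₁ _ hF', h₁ _ hF])

end

/-- Up to isomorphism, a finitely presented module is the cokernel of a morphism between sums of `P
i` indexed by `Fin n` and `Fin m`. This bounds both the colimit diagrams and the Hom types used
below. -/
instance : ObjectProperty.EssentiallySmall.{u} A.isFinPres where
  exists_small_le' := by
    let X : (Σ (n m : ℕ) (k : Fin n → I) (l : Fin m → I),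
      ((⨁ fun a => A.P (k a)) ⟶ (⨁ fun a => A.P (l a)))) → A.Gr := fun s => cokernel s.2.2.2.2
    refine ⟨ObjectProperty.ofObj X, inferInstance, ?_⟩
    rintro M ⟨F', F, ⟨ι, _, k, ⟨e⟩⟩, ⟨κ, _, l, ⟨e'⟩⟩, f, g, w, hex, hg⟩
    have aux : ∀ (ι : Type) [Finite ι] (k : ι → I), ∃ (n : ℕ) (k' : Fin n → I),
        Nonempty ((⨁ fun a => A.P (k a)) ≅ ⨁ fun a => A.P (k' a)) := fun ι _ k =>
      ⟨Nat.card ι, fun a => k ((Finite.equivFin ι).symm a),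
        ⟨biproduct.whiskerEquiv (Finite.equivFin ι) fun a =>
          eqToIso (by simp)⟩⟩
    obtain ⟨n, k', ⟨i⟩⟩ := aux ι k
    obtain ⟨m, l', ⟨i'⟩⟩ := aux κ l
    refine ⟨_, ⟨⟨n, m, k', l', (e ≪≫ i).inv ≫ f ≫ (e' ≪≫ i').hom⟩⟩, ⟨?_⟩⟩
    refine (hex.gIsCokernel.coconePointUniqueUpToIso (cokernelIsCokernel f)) ≪≫ ?_
    exact cokernel.mapIso _ _ (e ≪≫ i) (e' ≪≫ i') (by simp)

end IndexedAlgebra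

namespace IndexedAlgebra

variable {I : Type u} (A : IndexedAlgebra I)

/-! ### Modules as directed colimits of finitely presented ones. -/

section DirectedColimits

/-- An object of the category of objects over `M` satisfying `P`. -/
abbrev overMk {C : Type*} [Category* C] {P : ObjectProperty C} {M N : C} (hN : P N) (f : N ⟶ M) :
    CostructuredArrow P.ι M :=
  CostructuredArrow.mk (S := P.ι) (Y := ⟨N, hN⟩) (by exact f)

/-- A morphism in the category of objects over `M` satisfying `P`. -/
abbrev overHomMk {C : Type*} [Category* C] {P : ObjectProperty C} {M : C}
    {X Y : CostructuredArrow P.ι M} (f : X.left.obj ⟶ Y.left.obj) (w : f ≫ Y.hom = X.hom) : X ⟶ Y :=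
  CostructuredArrow.homMk (ObjectProperty.homMk f) w

/-- The category of objects over `M` satisfying `P` is filtered, if `P` is closed under finite
biproducts and cokernels. -/
lemma isFiltered_costructuredArrow {C : Type*} [Category* C] [Abelian C] {P : ObjectProperty C}
    (h0 : ∃ Z, P Z ∧ IsZero Z) (hbiprod : ∀ X Y, P X → P Y → P (X ⊞ Y))
    (hcok : ∀ X Y (f : X ⟶ Y), P X → P Y → P (cokernel f)) (M : C) :
    IsFiltered (CostructuredArrow P.ι M) where
  nonempty := by
    obtain ⟨Z, hZ, -⟩ := h0
    exact ⟨overMk hZ 0⟩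
  cocone_objs X Y := by
    exact ⟨overMk (hbiprod _ _ X.left.2 Y.left.2) (biprod.desc X.hom Y.hom),
      overHomMk biprod.inl (biprod.inl_desc _ _), overHomMk biprod.inr (biprod.inr_desc _ _),
      trivial⟩
  cocone_maps X Y f g := by
    have hf : f.left.hom ≫ Y.hom = X.hom := CostructuredArrow.w f
    have hg : g.left.hom ≫ Y.hom = X.hom := CostructuredArrow.w g
    have h : (f.left.hom - g.left.hom) ≫ Y.hom = 0 :=
      (Preadditive.sub_comp _ _ _).trans (sub_eq_zero.2 (hf.trans hg.symm))
    refine ⟨overMk (hcok _ _ (f.left.hom - g.left.hom) X.left.2 Y.left.2)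
      (cokernel.desc _ Y.hom h), overHomMk (cokernel.π _) (cokernel.π_desc _ _ _), ?_⟩
    · ext
      have h := cokernel.condition (f.left.hom - g.left.hom)
      rw [Preadditive.sub_comp, sub_eq_zero] at h
      exact h

/-- A module is a directed colimit of finitely presented modules with a given property if all its
elements come from such modules. -/
lemma directedColimits_of_exists {P : ObjectProperty A.Gr} (hP : P ≤ A.isFinPres)
    (h0 : ∃ Z, P Z ∧ IsZero Z) (hbiprod : ∀ X Y, P X → P Y → P (X ⊞ Y))
    (hcok : ∀ X Y (f : X ⟶ Y), A.isFinPres X → P Y → P (cokernel f)) (M : A.Gr)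
    (hM : ∀ (X : A.Ob) (m : M.obj.obj X), ∃ (N : A.Gr) (_ : P N) (f : N ⟶ M) (n : N.obj.obj X),
      f.hom.app X n = m) : directedColimits.{u} P M := by
  have := isFiltered_costructuredArrow h0 hbiprod (fun X Y f hX => hcok X Y f (hP _ hX)) M
  have : ObjectProperty.EssentiallySmall.{u} P := .of_le hP
  let e := equivSmallModel.{u} (CostructuredArrow P.ι M)
  have := IsFiltered.of_equivalence e
  -- A final functor from a directed poset turns the filtered diagram of all `P`-objects over `M`
  -- into a directed one.
  obtain ⟨α, _, _, _, F, hF⟩ := IsFiltered.exists_directed (SmallModel.{u} (CostructuredArrow P.ι M))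
  let G : α ⥤ CostructuredArrow P.ι M := F ⋙ e.inverse
  obtain ⟨hG₁, hG₂⟩ := G.final_iff_of_isFiltered.1 inferInstance
  let c : Cocone (G ⋙ CostructuredArrow.proj P.ι M ⋙ P.ι) :=
    { pt := M
      ι :=
        { app := fun j => (G.obj j).hom
          naturality := fun i j f => (CostructuredArrow.w (G.map f)).trans
            (Category.comp_id _).symm } }
  suffices hc : IsColimit c from
    ⟨α, inferInstance, inferInstance, inferInstance, ⟨⟨⟨_, c.ι, hc⟩, fun j => (G.obj j).left.2⟩⟩⟩
  have : PreservesColimitsOfShape α (forget AddCommGrpCat.{u}) := inferInstance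
  have : ReflectsColimitsOfShape α (forget AddCommGrpCat.{u}) :=
    reflectsColimitsOfShape_of_reflectsIsomorphisms
  refine isColimitOfReflects (AdditiveFunctor.forget _ _) (evaluationJointlyReflectsColimits _
    fun X => isColimitOfReflects (forget AddCommGrpCat.{u}) ?_)
  refine Types.FilteredColimit.isColimitOf' _ _ (fun m => ?_) fun j m m' hm => ?_
  · obtain ⟨N, hN, f, n, hn⟩ := hM X m
    obtain ⟨j, ⟨g⟩⟩ := hG₁ (overMk hN f)
    refine ⟨j, g.left.hom.hom.app X n, ?_⟩
    have hg : g.left.hom ≫ (G.obj j).hom = f := CostructuredArrow.w g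
    exact hn.symm.trans (congrArg (fun f => f.hom.app X n) hg).symm
  · let N : A.Gr := (G.obj j).left.1
    let f : N ⟶ M := (G.obj j).hom
    let x : N.obj.obj X := m
    let x' : N.obj.obj X := m'
    -- Two elements of `N` with the same image in `M` are identified by passing to the cokernel of
    -- the morphism `r` given by their difference; this cokernel is again a `P`-object over `M`.
    let r : A.P X.idx ⟶ N := corepHom (b := X) (x - x')
    have hr : r ≫ f = 0 := by
      refine (corepHom_comp (b := X) _ f).trans (corep_hom_ext ?_)
      rw [corepHom_app_id, map_sub]
      exact sub_eq_zero.2 hm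
    let Q : CostructuredArrow P.ι M := 
      overMk (hcok _ _ r (A.isFinPres_of_isFree _ (A.isFree_P _)) (G.obj j).left.2)
      (cokernel.desc r f hr)
    let q : G.obj j ⟶ Q := overHomMk (cokernel.π r) (cokernel.π_desc _ _ _)
    obtain ⟨k, ⟨g⟩⟩ := hG₁ Q
    let i := IsFiltered.leftToMax j k
    let i' := IsFiltered.rightToMax j k
    -- By finality, the transition map from `j` and the one through `Q` agree at a later stage `l`.
    obtain ⟨l, t, ht⟩ := hG₂ (q ≫ g ≫ G.map i') (G.map i)
    refine ⟨l, i ≫ t, ?_⟩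
    have h₁ : (cokernel.π r).hom.app X x = (cokernel.π r).hom.app X x' := by
      rw [← sub_eq_zero, ← map_sub]
      have h := cokernel_apply r (b := X) (𝟙 X)
      rwa [show r.hom.app X (𝟙 X) = _ from corepHom_app_id (b := X) _] at h
    have h₂ : G.map (i ≫ t) = q ≫ g ≫ G.map i' ≫ G.map t := by
      rw [G.map_comp, ← ht]
      simp
    have h₃ : (G.map (i ≫ t)).left.hom =
        cokernel.π r ≫ (g ≫ G.map i' ≫ G.map t).left.hom := by
      rw [h₂]; rfl
    change (G.map (i ≫ t)).left.hom.hom.app X m = (G.map (i ≫ t)).left.hom.hom.app X m'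
    rw [h₃]
    exact congrArg ((g ≫ G.map i' ≫ G.map t).left.hom.hom.app X) h₁

lemma directedColimits_isFinPres (M : A.Gr) : directedColimits.{u} A.isFinPres M := by
  refine A.directedColimits_of_exists le_rfl
    ⟨0, A.isFinPres_of_isFree _ A.isFree_zero, isZero_zero _⟩
    (fun X Y hX hY => hX.biprod A.isFree_biprod hY)
    (fun X Y f hX hY => FinPres.cokernel A.isFree_biprod A.projective_of_isFree f hX hY) M
    fun X m => ⟨A.P X.idx, A.isFinPres_of_isFree _ (A.isFree_P _), corepHom (b := X) m, 𝟙 X,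
      corepHom_app_id m⟩

end DirectedColimits

/-! ### Torsion modules and fractions with finitely presented source. -/

section Torsion

variable [PartialOrder I] [IsDirectedOrder I] [Nonempty I]

lemma directedColimits_Tors_le : directedColimits.{u} A.Tors ≤ A.Tors := by
  rintro M ⟨J, _, _, _, ⟨h⟩⟩
  refine (Tors_iff _).2 fun X m => ?_
  obtain ⟨j, y, rfl⟩ := Concrete.isColimit_exists_rep _
    (isColimitOfPreserves (evalAt X) h.isColimit) m
  obtain ⟨d, hd⟩ := (Tors_iff _).1 (h.prop_diag_obj j) X y
  refine ⟨d, fun Y a hY => ?_⟩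
  refine (naturality_apply (h.ι.app j) a y).symm.trans ?_
  rw [hd Y a hY, map_zero]

lemma Tors_of_isUpperBounded (M : A.Gr) (hM : A.isUpperBounded M) : A.Tors M := by
  obtain ⟨d, hd⟩ := hM
  exact (Tors_iff _).2 fun X m => ⟨d, fun Y a hY => hd _ hY _⟩

variable [A.PositivelyIndexed] [A.TailsCocompact]

lemma monoModSerre_iff {M N : A.Gr} (f : M ⟶ N) : A.Tors.monoModSerre f ↔
    ∀ (X : A.Ob) (m : M.obj.obj X), f.hom.app X m = 0 → ∃ d, m ∈ torsSubgroup M d X := by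
  rw [ObjectProperty.monoModSerre_iff, Tors_iff]
  refine ⟨fun h X m hm => ?_, fun h X y => ?_⟩
  · obtain ⟨y, rfl⟩ := exists_of_kernel f m hm
    obtain ⟨d, hd⟩ := h X y
    refine ⟨d, fun Y a hY => ?_⟩
    rw [← naturality_apply, hd Y a hY, map_zero]
  · obtain ⟨d, hd⟩ := h X _ (kernel_apply f y)
    refine ⟨d, fun Y a hY => injective_of_mono (kernel.ι f) Y ?_⟩
    rw [naturality_apply, hd Y a hY, map_zero]

/-- The class of `n` in the cokernel is torsion exactly when all its multiples of large degree lie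
in the image. -/
lemma epiModSerre_iff {M N : A.Gr} (f : M ⟶ N) : A.Tors.epiModSerre f ↔
    ∀ (X : A.Ob) (n : N.obj.obj X), ∃ d, ∀ (Y : A.Ob) (a : X ⟶ Y), d < Y.idx →
      ∃ m, f.hom.app Y m = N.obj.map a n := by
  rw [ObjectProperty.epiModSerre_iff, Tors_iff]
  refine ⟨fun h X n => ?_, fun h X y => ?_⟩
  · obtain ⟨d, hd⟩ := h X ((cokernel.π f).hom.app X n)
    refine ⟨d, fun Y a hY => exists_of_cokernel f _ ?_⟩
    rw [naturality_apply, hd Y a hY]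
  · obtain ⟨n, rfl⟩ := surjective_of_epi (cokernel.π f) X y
    obtain ⟨d, hd⟩ := h X n
    refine ⟨d, fun Y a hY => ?_⟩
    obtain ⟨m, hm⟩ := hd Y a hY
    rw [← naturality_apply, ← hm, cokernel_apply]

omit [IsDirectedOrder I] [Nonempty I] [A.TailsCocompact] in
/-- The inclusion of a tail in a module has an upper-bounded cokernel. -/
lemma isUpperBounded_cokernel_tailι (M : A.Gr) (d : I) :
    A.isUpperBounded (cokernel (tailι M d)) := by
  refine ⟨d, fun j hj m => ?_⟩
  obtain ⟨n, rfl⟩ := surjective_of_epi (cokernel.π (tailι M d)) ⟨j⟩ m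
  exact cokernel_apply (tailι M d) (b := ⟨j⟩) ⟨n, fun h => absurd hj h⟩

lemma isoModSerre_tailι (M : A.Gr) (d : I) : A.Tors.isoModSerre (tailι M d) :=
  A.Tors.isoModSerre_of_mono _ (A.Tors_of_isUpperBounded _ (A.isUpperBounded_cokernel_tailι M d))

/-- A finitely generated module mapping to a torsion module has a finitely generated submodule
with torsion cokernel on which the map vanishes. -/
lemma exists_isFree_of_Tors {N T : A.Gr} (hN : FinGen A.isFree N) (hT : A.Tors T) (q : N ⟶ T) :
    ∃ (F : A.Gr) (_ : A.isFree F) (j : F ⟶ N), j ≫ q = 0 ∧ A.Tors.epiModSerre j := by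
  obtain ⟨ι, _, k, x, hx⟩ := A.exists_generators N hN
  -- The bound is enlarged to exceed the degree of the generator, since tails `P_{i,>d}` are known
  -- to be finitely generated only for `i ≤ d`. The sum of the `P` covering these tails is the
  -- required `F`.
  have h : ∀ a, ∃ d, (k a).idx ≤ d ∧ q.hom.app _ (x a) ∈ torsSubgroup T d (k a) := fun a => by
    obtain ⟨d₀, hd₀⟩ := (Tors_iff _).1 hT _ (q.hom.app _ (x a))
    obtain ⟨d, h₁, h₂⟩ := exists_ge_ge (k a).idx d₀
    exact ⟨d, h₁, torsSubgroup_mono _ h₂ _ hd₀⟩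
  choose d hkd hd using h
  choose κ _ l y hy hgen using fun a => A.exists_generators_tail (k a) (d a) (hkd a)
  let φ : ∀ s : Σ a, κ a, A.P (l s.1 s.2).idx ⟶ N := fun s =>
    corepHom (b := l s.1 s.2) (N.obj.map (y s.1 s.2) (x s.1))
  refine ⟨⨁ fun s : Σ a, κ a => A.P (l s.1 s.2).idx, ⟨_, inferInstance, _, ⟨Iso.refl _⟩⟩,
    biproduct.desc φ, ?_, ?_⟩
  · refine biproduct.hom_ext' _ _ fun s => ?_
    rw [biproduct.ι_desc_assoc, comp_zero]
    refine (corepHom_comp _ q).trans (corep_hom_ext ?_)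
    rw [corepHom_app_id, naturality_apply]
    change _ = 0
    by_cases hs : d s.1 < (l s.1 s.2).idx
    · exact hd _ _ _ hs
    · rw [hy _ _ hs, Functor.map_zero]
      rfl
  · rw [epiModSerre_iff]
    intro X n
    obtain ⟨b, rfl⟩ := hx X n
    obtain ⟨v, hv⟩ := (Set.finite_range d).bddAbove
    refine ⟨v, fun Y a hY => ?_⟩
    have hd' : ∀ a, d a < Y.idx := fun a => lt_of_le_of_lt (hv ⟨a, rfl⟩) hY
    choose c hc using fun i => hgen i Y (b i ≫ a) (hd' i)
    refine ⟨∑ i, ∑ s, (biproduct.ι (fun s : Σ a, κ a => A.P (l s.1 s.2).idx) ⟨i, s⟩).hom.app Y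
      (c i s), ?_⟩
    rw [map_sum, map_sum]
    refine Finset.sum_congr rfl fun i _ => ?_
    rw [map_sum, ← map_comp_apply, hc, sum_map_apply]
    refine Finset.sum_congr rfl fun s _ => ?_
    have h := congrArg (fun f => f.hom.app Y (c i s)) (biproduct.ι_desc φ ⟨i, s⟩)
    exact h.trans (map_comp_apply N _ _ _).symm

variable [A.Coherent]

/-- Every morphism to a finitely presented module which is an isomorphism modulo torsion is
dominated by one whose source is finitely presented. -/
lemma exists_isFinPres_of_isoModSerre {X X' : A.Gr} (hX : A.isFinPres X) (s : X' ⟶ X)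
    (hs : A.Tors.isoModSerre s) :
    ∃ (Z : A.Gr) (_ : A.isFinPres Z) (z : Z ⟶ X'), A.Tors.isoModSerre z := by
  have hX' := hX.cohMod A.isFree_biprod A.projective_of_isFree A.isFree_le_isCohMod
  obtain ⟨F, hF, j, hj, hj'⟩ := A.exists_isFree_of_Tors hX'.1 hs.2 (cokernel.π s)
  have := A.projective_of_isFree F hF
  -- `F` maps to `X` inside the image of `s`, so it lifts to `X'` by projectivity. The lift need not
  -- kill `kernel j`, but sends it into the torsion module `kernel s`; as `kernel j` is finitely
  -- generated by coherence, a free `F'` covers it modulo torsion and is killed by `l`. Then `F /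
  -- F'` is the desired module.
  let l : F ⟶ X' := (ShortComplex.exact_cokernel s).liftFromProjective j hj
  have hl : l ≫ s = j := (ShortComplex.exact_cokernel s).liftFromProjective_comp j hj
  have hκ : (kernel.ι j ≫ l) ≫ s = 0 := by rw [Category.assoc, hl, kernel.condition]
  obtain ⟨F', hF', j', hj₁, hj₂⟩ := A.exists_isFree_of_Tors (hX'.2 F hF j) hs.1
    (kernel.lift s _ hκ)
  have hw : (j' ≫ kernel.ι j) ≫ l = 0 := by
    simpa using hj₁ =≫ kernel.ι s
  have hw' : (j' ≫ kernel.ι j) ≫ j = 0 := by simp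
  refine ⟨cokernel (j' ≫ kernel.ι j), FinPres.cokernel A.isFree_biprod A.projective_of_isFree _
    (A.isFinPres_of_isFree _ hF') (A.isFinPres_of_isFree _ hF), cokernel.desc _ l hw, ?_⟩
  -- By two-out-of-three it suffices to treat the composite `F / F' ⟶ X`, whose kernel is `kernel j`
  -- modulo the image of `F'`.
  refine MorphismProperty.of_postcomp _ _ s hs ?_
  have e : cokernel.desc _ l hw ≫ s = cokernel.desc _ j hw' := by
    rw [← cancel_epi (cokernel.π (j' ≫ kernel.ι j))]; simp [hl]
  rw [e]
  refine ⟨?_, ?_⟩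
  · rw [monoModSerre_iff]
    intro Y z hz
    obtain ⟨f, rfl⟩ := surjective_of_epi (cokernel.π (j' ≫ kernel.ι j)) Y z
    rw [← comp_app_apply, cokernel.π_desc] at hz
    obtain ⟨g, rfl⟩ := exists_of_kernel j f hz
    obtain ⟨d, hd⟩ := (A.epiModSerre_iff j').1 hj₂ Y g
    refine ⟨d, fun W a hW => ?_⟩
    obtain ⟨m, hm⟩ := hd W a hW
    rw [← naturality_apply, ← naturality_apply, ← hm, ← comp_app_apply j', cokernel_apply]
  · have h := hj'
    rw [← cokernel.π_desc (j' ≫ kernel.ι j) j hw'] at h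
    exact A.Tors.prop_of_epi (cokernel.map _ _ (cokernel.π _) (𝟙 _) (by simp)) h

omit [A.Coherent] in
lemma Tors_eq_directedColimits : A.Tors = directedColimits.{u} (A.tors.map A.ι) := by
  have h : A.tors.map A.ι = A.isFinPres ⊓ A.Tors := by
    ext M
    constructor
    · rintro ⟨N, hN, ⟨e⟩⟩
      exact ⟨A.isFinPres.prop_of_iso e N.2, A.Tors.prop_of_iso e hN⟩
    · rintro ⟨h₁, h₂⟩
      exact ⟨⟨M, h₁⟩, h₂, ⟨Iso.refl _⟩⟩
  rw [h]
  refine le_antisymm (fun M hM => ?_) fun M hM => A.directedColimits_Tors_le M ?_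
  · refine A.directedColimits_of_exists inf_le_left
      ⟨0, ⟨A.isFinPres_of_isFree _ A.isFree_zero, A.Tors.prop_of_isZero (isZero_zero _)⟩,
        isZero_zero _⟩
      (fun X Y hX hY => ⟨hX.1.biprod A.isFree_biprod hY.1, ?_⟩)
      (fun X Y f hX hY => ⟨FinPres.cokernel A.isFree_biprod A.projective_of_isFree f hX hY.1,
        A.Tors.prop_of_epi (cokernel.π f) hY.2⟩) M
      fun X m => ?_
    · have hS := (ShortComplex.Splitting.ofHasBinaryBiproduct X Y).shortExact
      exact A.Tors.prop_X₂_of_shortExact hS hX.2 hY.2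
    · obtain ⟨d₀, hd₀⟩ := (Tors_iff M).1 hM X m
      obtain ⟨d, hd, hd'⟩ := exists_ge_ge X.idx d₀
      have hm := torsSubgroup_mono M hd' X hd₀
      let f : A.P X.idx ⟶ M := corepHom (b := X) m
      refine ⟨cokernel (tailι (A.P X.idx) d), ⟨TailsCocompact.isFinPres_quotient _ _ hd,
        A.Tors_of_isUpperBounded _ (A.isUpperBounded_cokernel_tailι _ d)⟩,
        cokernel.desc _ f ?_, (cokernel.π (tailι (A.P X.idx) d)).hom.app X (𝟙 X), ?_⟩
      · ext Y a
        by_cases hY : d < Y.idx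
        · exact hm Y a.1 hY
        · obtain ⟨a, ha⟩ := a
          -- Outside degrees `> d` the tail has only the zero element.
          obtain rfl := ha hY
          exact map_zero (f.hom.app Y).hom
      · refine (congrArg (fun f => f.hom.app X (𝟙 X)) (cokernel.π_desc (tailι (A.P X.idx) d) f _)).trans ?_
        exact corepHom_app_id m
  · obtain ⟨J, h₁, h₂, h₃, h₄⟩ := hM
    exact ⟨J, h₁, h₂, h₃, ObjectProperty.colimitsOfShape_monotone _ inf_le_right _ h₄⟩

end Torsion

end IndexedAlgebra

namespace IndexedAlgebra

variable {I : Type u} (A : IndexedAlgebra I)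

/-! ### The category of modules is Grothendieck. -/

section Grothendieck

lemma isSeparating_P : (ObjectProperty.ofObj A.P).IsSeparating := by
  intro M N f g h
  ext X m
  have h' := h (A.P X.idx) ⟨X.idx⟩ (corepHom (b := X) m)
  have h'' : corepHom (b := X) (f.hom.app X m) = corepHom (b := X) (g.hom.app X m) :=
    (corepHom_comp m f).symm.trans (h'.trans (corepHom_comp m g))
  exact (corepHom_app_id _).symm.trans
    ((congrArg (fun k => k.hom.app X (𝟙 X)) h'').trans (corepHom_app_id _))

instance : HasSeparator A.Gr :=
  ⟨_, (A.isSeparating_P).isSeparator_coproduct⟩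

instance : IsGrothendieckAbelian.{u} A.Gr where
  locallySmall := inferInstance
  hasFilteredColimitsOfSize := ⟨fun J _ _ => inferInstance⟩
  ab5OfSize := by
    have : HasFilteredColimitsOfSize.{u, u} A.Gr := ⟨fun J _ _ => inferInstance⟩
    refine ⟨fun J _ _ => ?_⟩
    have : ReflectsFiniteLimits (AdditiveFunctor.forget A.Ob AddCommGrpCat.{u}) :=
      ⟨fun _ _ _ => inferInstance⟩
    exact HasExactColimitsOfShape.domain_of_functor J
      (AdditiveFunctor.forget A.Ob AddCommGrpCat.{u})
  hasSeparator := inferInstance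

end Grothendieck

/-! ### Cocontinuity of the quotient functor and existence of its right adjoint. -/

section Torsion

variable [PartialOrder I] [IsDirectedOrder I] [Nonempty I]

variable {A} in
/-- The torsion submodule of a module. -/
def torsionPart (M : A.Gr) (X : A.Ob) : AddSubgroup (M.obj.obj X) where
  carrier := {m | ∃ d, m ∈ torsSubgroup M d X}
  zero_mem' := ⟨Classical.arbitrary I, zero_mem _⟩
  add_mem' := by
    rintro a b ⟨d, hd⟩ ⟨d', hd'⟩
    obtain ⟨e, h, h'⟩ := exists_ge_ge d d'
    exact ⟨e, add_mem (torsSubgroup_mono M h X hd) (torsSubgroup_mono M h' X hd')⟩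
  neg_mem' := by
    rintro a ⟨d, hd⟩
    exact ⟨d, neg_mem hd⟩

variable {A} in
lemma torsionPart_map (M : A.Gr) ⦃X Y : A.Ob⦄ (a : X ⟶ Y) (m : M.obj.obj X)
    (hm : m ∈ torsionPart M X) : M.obj.map a m ∈ torsionPart M Y := by
  obtain ⟨d, hd⟩ := hm
  exact ⟨d, torsSubgroup_map M d a m hd⟩

/-- The lift of a morphism to a subfunctor containing its values. -/
def subLift {B : Type u} [Category.{u} B] [Preadditive B] {M N : B ⥤+ AddCommGrpCat.{u}}
    {K : ∀ b, AddSubgroup (N.obj.obj b)}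
    (hK : ∀ ⦃b c : B⦄ (a : b ⟶ c), ∀ x ∈ K b, N.obj.map a x ∈ K c) (f : M ⟶ N)
    (hf : ∀ b x, f.hom.app b x ∈ K b) : M ⟶ sub N K hK :=
  ObjectProperty.homMk
    { app := fun b => AddCommGrpCat.ofHom ((f.hom.app b).hom.codRestrict (K b) (hf b))
      naturality := fun b c a => by
        ext x
        exact Subtype.ext (naturality_apply f a x) }

/-- A morphism out of a colimit has torsion values if it does so on the diagram. -/
lemma mem_torsionPart_of_isColimit {J : Type*} [Category* J] {K : J ⥤ A.Gr} {c : Cocone K}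
    (hc : IsColimit c) {N : A.Gr} (f : c.pt ⟶ N)
    (hf : ∀ j X m, (c.ι.app j ≫ f).hom.app X m ∈ torsionPart N X) (X : A.Ob)
    (m : c.pt.obj.obj X) : f.hom.app X m ∈ torsionPart N X := by
  let i := subι N (torsionPart N) (torsionPart_map N)
  let s : Cocone K :=
    { pt := sub N (torsionPart N) (torsionPart_map N)
      ι :=
        { app := fun j => subLift (torsionPart_map N) (c.ι.app j ≫ f) (hf j)
          naturality := fun j j' a => by
            ext X m
            refine Subtype.ext (a1 := ⟨_, hf _ _ _⟩) (a2 := ⟨_, hf _ _ _⟩) ?_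
            exact congrArg (fun k => (k ≫ f).hom.app X m) (c.w a) } }
  -- The torsion elements of `N` form a submodule, through which every leg, hence `f`, factors.
  have h : hc.desc s ≫ i = f := hc.hom_ext fun j => by
    rw [hc.fac_assoc]
    rfl
  rw [← h]
  exact ((hc.desc s).hom.app X m).2

lemma Tors_of_isColimit {J : Type*} [Category* J] {K : J ⥤ A.Gr} {c : Cocone K}
    (hc : IsColimit c) (hK : ∀ j, A.Tors (K.obj j)) : A.Tors c.pt :=
  (Tors_iff _).2 fun X m => A.mem_torsionPart_of_isColimit hc (𝟙 _) (fun j X m => by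
    obtain ⟨d, hd⟩ := (Tors_iff _).1 (hK j) X m
    refine ⟨d, fun Y a hY => ?_⟩
    refine (naturality_apply (c.ι.app j) a m).symm.trans ?_
    rw [hd Y a hY, map_zero]) X m

variable [A.PositivelyIndexed] [A.TailsCocompact]

lemma π_map_eq_zero_iff {M N : A.Gr} (f : M ⟶ N) :
    A.π.map f = 0 ↔ ∀ X m, f.hom.app X m ∈ torsionPart N X := by
  rw [ObjectProperty.SerreClassLocalization.map_eq_zero_iff A.π A.Tors, Tors_iff]
  refine ⟨fun h X m => ?_, fun h X y => ?_⟩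
  · obtain ⟨d, hd⟩ := h X ((Abelian.factorThruImage f).hom.app X m)
    refine ⟨d, fun Y a hY => ?_⟩
    have e := congrArg (fun k => k.hom.app X m) (Abelian.image.fac f)
    dsimp only at e
    rw [← e, comp_app_apply, ← naturality_apply, hd Y a hY, map_zero]
  · obtain ⟨m, rfl⟩ := surjective_of_epi (Abelian.factorThruImage f) X y
    obtain ⟨d, hd⟩ := h X m
    refine ⟨d, fun Y a hY => injective_of_mono (Abelian.image.ι f) Y ?_⟩
    rw [naturality_apply, ← comp_app_apply, Abelian.image.fac, hd Y a hY, map_zero]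

/-- Coproducts of isomorphisms modulo torsion are isomorphisms modulo torsion. -/
lemma isoModSerre_colimMap {J : Type u} {K K' : Discrete J ⥤ A.Gr} (α : K ⟶ K')
    (hα : ∀ j, A.Tors.isoModSerre (α.app j)) : A.Tors.isoModSerre (colimMap α) := by
  refine ⟨?_, ?_⟩
  -- Coproducts are exact in `Gr A`, so the kernel of the coproduct is the coproduct of the torsion
  -- kernels.
  · have e : colim.obj (kernel α) ≅ kernel (colimMap α) := PreservesKernel.iso colim α
    refine A.Tors.prop_of_iso e (A.Tors_of_isColimit (colimit.isColimit _) fun j => ?_)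
    exact A.Tors.prop_of_iso (PreservesKernel.iso ((evaluation _ _).obj j) α).symm (hα j).1
  · have e : colim.obj (cokernel α) ≅ cokernel (colimMap α) := PreservesCokernel.iso colim α
    refine A.Tors.prop_of_iso e (A.Tors_of_isColimit (colimit.isColimit _) fun j => ?_)
    exact A.Tors.prop_of_iso (PreservesCokernel.iso ((evaluation _ _).obj j) α).symm (hα j).2

/-- Writing `f` as a left fraction replaces it by a morphism of modules whose restriction to each `K
j` has torsion values; then so has the whole. This is the uniqueness half of cocontinuity of `π`. -/
lemma π_hom_ext {J : Type*} [Category* J] {K : J ⥤ A.Gr} {c : Cocone K} (hc : IsColimit c)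
    {Y : A.QGr} (f : A.π.obj c.pt ⟶ Y) (hf : ∀ j, A.π.map (c.ι.app j) ≫ f = 0) : f = 0 := by
  have := Localization.essSurj A.π A.Tors.isoModSerre
  obtain ⟨φ, hφ⟩ := Localization.exists_leftFraction A.π A.Tors.isoModSerre
    (f ≫ (A.π.objObjPreimageIso Y).inv)
  have := Localization.inverts A.π A.Tors.isoModSerre φ.s φ.hs
  have h : f ≫ (A.π.objObjPreimageIso Y).inv ≫ A.π.map φ.s = A.π.map φ.f := by
    rw [← Category.assoc, hφ, MorphismProperty.LeftFraction.map_comp_map_s]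
  have h0 : A.π.map φ.f = 0 := by
    rw [π_map_eq_zero_iff]
    refine A.mem_torsionPart_of_isColimit hc _ fun j => ?_
    rw [← π_map_eq_zero_iff, Functor.map_comp, ← h, reassoc_of% hf j, zero_comp]
  rw [h0] at h
  rw [← cancel_mono ((A.π.objObjPreimageIso Y).inv ≫ A.π.map φ.s), h, zero_comp]

instance (J : Type u) : PreservesColimitsOfShape (Discrete J) A.π where
  preservesColimit {K} := by
    have := Localization.essSurj A.π A.Tors.isoModSerre
    have hdesc : ∀ s : Cocone (K ⋙ A.π), ∃ f : A.π.obj (colimit K) ⟶ s.pt,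
        ∀ j, A.π.map (colimit.ι K j) ≫ f = s.ι.app j := fun s => by
      -- Each leg is a right fraction; the coproduct of the denominators is still inverted by `π`,
      -- so the coproduct of the fractions is the induced morphism.
      choose φ hφ using fun j => Localization.exists_rightFraction A.π A.Tors.isoModSerre
        (X := K.obj j) (s.ι.app j ≫ (A.π.objObjPreimageIso s.pt).inv)
      let K' : Discrete J ⥤ A.Gr := Discrete.functor fun j => (φ ⟨j⟩).X'
      let α : K' ⟶ K := Discrete.natTrans fun j => (φ j).s
      have hα := A.isoModSerre_colimMap α fun j => (φ j).hs
      have := Localization.inverts A.π A.Tors.isoModSerre _ hα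
      have := fun j => Localization.inverts A.π A.Tors.isoModSerre _ (φ j).hs
      let g : colimit K' ⟶ A.π.objPreimage s.pt :=
        colimit.desc K' ⟨_, Discrete.natTrans fun j => (φ j).f⟩
      refine ⟨inv (A.π.map (colimMap α)) ≫ A.π.map g ≫ (A.π.objObjPreimageIso s.pt).hom,
        fun j => ?_⟩
      have h₁ : A.π.map (φ j).s ≫ A.π.map (colimit.ι K j) =
          A.π.map (colimit.ι K' j) ≫ A.π.map (colimMap α) := by
        rw [← Functor.map_comp, ← Functor.map_comp, ι_colimMap]
        rfl
      have h₂ : A.π.map (φ j).s ≫ s.ι.app j =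
          A.π.map (φ j).f ≫ (A.π.objObjPreimageIso s.pt).hom := by
        rw [← cancel_mono (A.π.objObjPreimageIso s.pt).inv, Category.assoc, hφ,
          MorphismProperty.RightFraction.map_s_comp_map]
        simp
      have h₃ : A.π.map (colimit.ι K' j) ≫ A.π.map g = A.π.map (φ j).f :=
        (A.π.map_comp _ _).symm.trans (congrArg A.π.map (colimit.ι_desc _ _))
      rw [← cancel_epi (A.π.map (φ j).s), h₂, reassoc_of% h₁, IsIso.hom_inv_id_assoc,
        reassoc_of% h₃]
    choose desc fac using hdesc
    refine preservesColimit_of_preserves_colimit_cocone (colimit.isColimit K)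
      ⟨desc, fun s j => fac s j, fun s m hm => ?_⟩
    rw [← sub_eq_zero]
    refine A.π_hom_ext (colimit.isColimit K) _ fun j => ?_
    rw [Preadditive.comp_sub, sub_eq_zero]
    exact (hm j).trans (fac s j).symm

instance : PreservesFiniteLimits A.π :=
  ObjectProperty.SerreClassLocalization.preservesFiniteLimits A.π A.Tors

instance : PreservesFiniteColimits A.π :=
  ObjectProperty.SerreClassLocalization.preservesFiniteColimits A.π A.Tors

instance : PreservesColimitsOfSize.{u, u} A.π :=
  preservesColimits_of_preservesCoequalizers_and_coproducts A.π

variable [A.Coherent]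

lemma exists_rightFraction_isFinPres {X M : A.Gr} (hX : A.isFinPres X)
    (f : A.π.obj X ⟶ A.π.obj M) :
    ∃ (Z : A.Gr) (_ : A.isFinPres Z) (s : Z ⟶ X) (_ : A.Tors.isoModSerre s) (g : Z ⟶ M),
      A.π.map s ≫ f = A.π.map g := by
  obtain ⟨φ, rfl⟩ := Localization.exists_rightFraction A.π A.Tors.isoModSerre f
  obtain ⟨Z, hZ, z, hz⟩ := A.exists_isFinPres_of_isoModSerre hX φ.s φ.hs
  refine ⟨Z, hZ, z ≫ φ.s, MorphismProperty.comp_mem _ _ _ hz φ.hs, z ≫ φ.f, ?_⟩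
  rw [Functor.map_comp, Functor.map_comp, Category.assoc,
    MorphismProperty.RightFraction.map_s_comp_map]

/-- A localization need not be locally small; here fractions with source in a small set of finitely
presented modules suffice. -/
lemma small_hom_π {X : A.Gr} (hX : A.isFinPres X) (Y : A.QGr) : Small.{u} (A.π.obj X ⟶ Y) := by
  have := Localization.essSurj A.π A.Tors.isoModSerre
  obtain ⟨M, ⟨e⟩⟩ : ∃ M, Nonempty (A.π.obj M ≅ Y) := ⟨_, ⟨A.π.objObjPreimageIso Y⟩⟩
  obtain ⟨Q, hQ, hQ₁, hQ₂⟩ := ObjectProperty.EssentiallySmall.exists_small_le.{u} A.isFinPres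
  have hs : Small.{u} (Subtype Q) := hQ
  let S := Σ (Z : Subtype Q), { s : Z.1 ⟶ X // A.Tors.isoModSerre s } × (Z.1 ⟶ M)
  refine small_of_surjective (α := S) (f := fun x =>
    (Localization.isoOfHom A.π A.Tors.isoModSerre
      x.2.1.1 x.2.1.2).inv ≫ A.π.map x.2.2 ≫ e.hom) ?_
  intro f
  obtain ⟨Z, hZ, s, hs, g, h⟩ := A.exists_rightFraction_isFinPres hX (f ≫ e.inv)
  obtain ⟨Z', hZ', ⟨i⟩⟩ := hQ₂ _ hZ
  refine ⟨⟨⟨Z', hZ'⟩, ⟨i.inv ≫ s, (A.Tors.isoModSerre.cancel_left_of_respectsIso _ _).2 hs⟩,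
    i.inv ≫ g⟩, ?_⟩
  rw [Iso.inv_comp_eq]
  change A.π.map (i.inv ≫ g) ≫ e.hom = A.π.map (i.inv ≫ s) ≫ f
  rw [Functor.map_comp, Functor.map_comp, Category.assoc, ← reassoc_of% h]
  simp

/-- Special adjoint functor theorem: the morphisms `π P_i ⟶ Y` form a small separating family in the
category of modules over `Y`, which therefore has a terminal object. -/
instance : A.π.IsLeftAdjoint := by
  have : ∀ Y, HasTerminal (CostructuredArrow A.π Y) := fun Y => by
    have : ObjectProperty.Small.{u} ((ObjectProperty.ofObj A.P).inverseImage
        (CostructuredArrow.proj A.π Y)) := by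
      have := fun i => A.small_hom_π (A.isFinPres_of_isFree _ (A.isFree_P i)) Y
      refine small_of_surjective (α := Σ i, A.π.obj (A.P i) ⟶ Y)
        (f := fun x => ⟨CostructuredArrow.mk x.2, ⟨x.1⟩⟩) ?_
      rintro ⟨⟨X, ⟨⟨⟩⟩, f⟩, hX⟩
      obtain ⟨i, hi⟩ := (ObjectProperty.ofObj_iff _ _).1 hX
      obtain rfl : A.P i = X := hi
      exact ⟨⟨i, f⟩, rfl⟩
    exact hasTerminal_of_isSeparating.{u}
      (CostructuredArrow.isSeparating_inverseImage_proj A.π Y A.isSeparating_P)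
  exact isLeftAdjoint_of_costructuredArrowTerminals _

end Torsion

end IndexedAlgebra

/-- The counit of an adjunction is an isomorphism if the left adjoint is a localization functor. -/
lemma isIso_counit_of_isLocalization {C D : Type*} [Category* C] [Category* D] {L : C ⥤ D}
    {R : D ⥤ C} (adj : L ⊣ R) (W : MorphismProperty C) [L.IsLocalization W] :
    IsIso adj.counit := by
  let _ : Localization.Lifting L W (L ⋙ R ⋙ L) (R ⋙ L) := ⟨Iso.refl _⟩
  -- The inverse of the counit is the descent of `L η` along the localization.
  let δ : 𝟭 D ⟶ R ⋙ L :=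
    Localization.liftNatTrans L W L (L ⋙ R ⋙ L) (𝟭 D) (R ⋙ L) (Functor.whiskerRight adj.unit L)
  have hδ : ∀ X, δ.app (L.obj X) = L.map (adj.unit.app X) := fun X => by
    refine (Localization.liftNatTrans_app L W L (L ⋙ R ⋙ L) (𝟭 D) (R ⋙ L) _ X).trans ?_
    exact (Category.id_comp _).trans (Category.comp_id (L.map (adj.unit.app X)))
  refine ⟨δ, ?_, ?_⟩
  · ext Y
    have h := δ.naturality (adj.counit.app Y)
    dsimp at h ⊢
    rw [h, hδ, ← L.map_comp, adj.right_triangle_components]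
    exact L.map_id _
  · refine Localization.natTrans_ext L W fun X => ?_
    rw [NatTrans.comp_app, hδ]
    exact adj.left_triangle_components X

/-! ### Local modules, and compatibility of the section functor with filtered colimits. -/

namespace IndexedAlgebra

variable {I : Type u} (A : IndexedAlgebra I)
variable [PartialOrder I] [IsDirectedOrder I] [Nonempty I] [A.PositivelyIndexed]

/-- The inclusions of the tails `P_{i, > d}` in `P_i`, for `i ≤ d`. -/
def tailInclusions : MorphismProperty A.Gr :=
  MorphismProperty.ofHoms fun x : { x : I × I // x.1 ≤ x.2 } => tailι (A.P x.1.1) x.1.2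

omit [IsDirectedOrder I] [Nonempty I] in
lemma tailInclusions_tailι {i d : I} (h : i ≤ d) : A.tailInclusions (tailι (A.P i) d) :=
  MorphismProperty.ofHoms.mk (f := fun x : { x : I × I // x.1 ≤ x.2 } => tailι (A.P x.1.1) x.1.2)
    ⟨(i, d), h⟩

variable [A.TailsCocompact]

section

attribute [local instance] Cardinal.fact_isRegular_aleph0

/-- Sources and targets of the tail inclusions are finitely presented, the tails being finitely
generated submodules of the coherent modules `P i`. -/
instance [A.Coherent] (J : Type u) [SmallCategory J] [IsFiltered J] :
    A.tailInclusions.isLocal.IsClosedUnderColimitsOfShape J := by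
  have := (isCardinalFiltered_aleph0_iff.{u} J).2 inferInstance
  refine MorphismProperty.isClosedUnderColimitsOfShape_isLocal _ J Cardinal.aleph0.{u} ?_
  rintro _ _ _ ⟨⟨⟨i, d⟩, h⟩⟩
  refine ⟨A.isFinitelyPresentable_of_isFinPres ?_, inferInstanceAs (IsFinitelyPresentable _)⟩
  have hP := A.isFree_le_isCohMod _ (A.isFree_P i)
  exact (hP.of_subobject (tailι (A.P i) d) (A.finGen_tail h)).finPres

end

variable {A} {ω : A.QGr ⥤ A.Gr} (adj : A.π ⊣ ω)

include adj

lemma isIso_counit : IsIso adj.counit :=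
  isIso_counit_of_isLocalization adj A.Tors.isoModSerre

lemma full_section : ω.Full :=
  have := isIso_counit adj
  (adj.fullyFaithfulROfIsIsoCounit).full

lemma faithful_section : ω.Faithful :=
  have := isIso_counit adj
  (adj.fullyFaithfulROfIsIsoCounit).faithful

lemma isIso_π_map_unit (M : A.Gr) : IsIso (A.π.map (adj.unit.app M)) := by
  have := isIso_counit adj
  have h := adj.left_triangle_components M
  exact ⟨adj.counit.app _, h, by
    rw [← cancel_mono (adj.counit.app (A.π.obj M)), Category.assoc, h]
    simp⟩

lemma isoModSerre_unit (M : A.Gr) : A.Tors.isoModSerre (adj.unit.app M) :=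
  (ObjectProperty.SerreClassLocalization.isIso_map_iff A.π A.Tors _).1 (isIso_π_map_unit adj M)

lemma isLocal_section (Y : A.QGr) : A.Tors.isoModSerre.isLocal (ω.obj Y) := by
  intro M N s hs
  have := Localization.inverts A.π A.Tors.isoModSerre s hs
  have e : (fun f : N ⟶ ω.obj Y => s ≫ f) =
      (adj.homEquiv M Y) ∘ (fun f => A.π.map s ≫ f) ∘ (adj.homEquiv N Y).symm := by
    ext f : 1
    simp [Adjunction.homEquiv_naturality_left]
  rw [e]
  refine (Equiv.bijective _).comp (Function.Bijective.comp ⟨fun f g h => ?_, fun f => ?_⟩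
    (Equiv.bijective _))
  · exact (cancel_epi (A.π.map s)).1 h
  · exact ⟨inv (A.π.map s) ≫ f, by simp⟩

lemma isLocal_tailInclusions_section (Y : A.QGr) : A.tailInclusions.isLocal (ω.obj Y) :=
  fun _ _ f hf => isLocal_section adj Y f (by
    obtain ⟨x⟩ := hf
    exact A.isoModSerre_tailι _ _)

omit adj [IsDirectedOrder I] [Nonempty I] [A.TailsCocompact] in
lemma tailι_comp_corepHom_eq_zero {M : A.Gr} {X : A.Ob} {d : I} {m : M.obj.obj X}
    (hm : m ∈ torsSubgroup M d X) :
    tailι (A.P X.idx) d ≫ (show A.P X.idx ⟶ M from corepHom (b := X) m) = 0 := by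
  ext Y a
  by_cases hY : d < Y.idx
  · exact hm Y a.1 hY
  · obtain ⟨a, ha⟩ := a
    obtain rfl := ha hY
    exact map_zero ((show A.P X.idx ⟶ M from corepHom (b := X) m).hom.app Y).hom

-- Local modules are torsion-free: the morphism `P_i ⟶ M` given by a torsion element vanishes on a
-- tail, hence everywhere.
omit adj [A.TailsCocompact] [Nonempty I] in
lemma eq_zero_of_isLocal {M : A.Gr} (hM : A.tailInclusions.isLocal M) {X : A.Ob} {d : I}
    {m : M.obj.obj X} (hm : m ∈ torsSubgroup M d X) : m = 0 := by
  obtain ⟨e, hXe, hde⟩ := exists_ge_ge X.idx d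
  have h : (show A.P X.idx ⟶ M from corepHom (b := X) m) = 0 :=
    (hM (tailι (A.P X.idx) e) (tailInclusions_tailι A hXe)).1 (by
      dsimp only
      rw [comp_zero, tailι_comp_corepHom_eq_zero (torsSubgroup_mono M hde X hm)])
  exact (corepHom_app_id m).symm.trans (congrArg (fun k => k.hom.app X (𝟙 X)) h)

/-- The unit is always an isomorphism modulo torsion. Locality makes its torsion kernel zero, and
lets an element that lies in the image only after multiplication into high degree be lifted itself.
-/
lemma isIso_unit_of_isLocal (M : A.Gr) (hM : A.tailInclusions.isLocal M) :
    IsIso (adj.unit.app M) := by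
  have hη := isoModSerre_unit adj M
  have hN := isLocal_tailInclusions_section adj (A.π.obj M)
  have hmono : Mono (adj.unit.app M) := by
    refine mono_of_injective _ fun X => (injective_iff_map_eq_zero _).2 fun m hm => ?_
    obtain ⟨d, hd⟩ := (A.monoModSerre_iff _).1 hη.1 X m hm
    exact eq_zero_of_isLocal hM hd
  have hepi : Epi (adj.unit.app M) := by
    refine epi_of_surjective _ fun X x => ?_
    obtain ⟨d₀, hd₀⟩ := (A.epiModSerre_iff _).1 hη.2 X x
    obtain ⟨d, hXd, hd⟩ := exists_ge_ge X.idx d₀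
    let f : A.P X.idx ⟶ ω.obj (A.π.obj M) := corepHom (b := X) x
    have hf : (tailι (A.P X.idx) d ≫ f) ≫ cokernel.π (adj.unit.app M) = 0 := by
      ext Y a
      by_cases hY : d < Y.idx
      · obtain ⟨m, hm⟩ := hd₀ Y a.1 (lt_of_le_of_lt hd hY)
        refine Eq.trans ?_ (cokernel_apply (adj.unit.app M) m)
        exact congrArg _ hm.symm
      · obtain ⟨a, ha⟩ := a
        obtain rfl := ha hY
        exact map_zero ((f ≫ cokernel.π (adj.unit.app M)).hom.app Y).hom
    let l := (ShortComplex.exact_cokernel (adj.unit.app M)).lift _ hf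
    have hl : l ≫ adj.unit.app M = tailι (A.P X.idx) d ≫ f :=
      (ShortComplex.exact_cokernel (adj.unit.app M)).lift_f _ hf
    -- Locality of `M` extends `l` from the tail to `P_i`; locality of `ω π M` shows that the
    -- extension maps to `f`, since the two agree on the tail.
    obtain ⟨g, hg⟩ := (hM (tailι (A.P X.idx) d) (tailInclusions_tailι A hXd)).2 l
    dsimp only at hg
    have h : g ≫ adj.unit.app M = f :=
      (hN (tailι (A.P X.idx) d) (tailInclusions_tailι A hXd)).1 (by
        dsimp only
        rw [← hl, ← hg, Category.assoc])
    exact ⟨g.hom.app X (𝟙 X), (congrArg (fun k => k.hom.app X (𝟙 X)) h).trans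
      (corepHom_app_id x)⟩
  exact isIso_of_mono_of_epi _

variable [A.Coherent]

/-- The comparison `f` becomes invertible under `π`, as `π` is cocontinuous and `π ω ≅ 𝟭`. Both its
ends are local, so their units are invertible, and naturality of the unit makes `f` itself
invertible. -/
lemma preservesFilteredColimits_section : PreservesFilteredColimitsOfSize.{u, u} ω where
  preserves_filtered_colimits J _ _ := ⟨fun {K} => ⟨fun {c} hc => by
    have := isIso_counit adj
    have : PreservesColimitsOfShape J (ω ⋙ A.π) :=
      preservesColimitsOfShape_of_natIso (asIso adj.counit).symm
    let f := colimit.desc (K ⋙ ω) (ω.mapCocone c)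
    have h₁ : A.tailInclusions.isLocal (colimit (K ⋙ ω)) :=
      ObjectProperty.prop_of_isColimit _ (colimit.isColimit _)
        fun j => isLocal_tailInclusions_section adj _
    have := isIso_unit_of_isLocal adj _ h₁
    have := isIso_unit_of_isLocal adj _ (isLocal_tailInclusions_section adj c.pt)
    have h₂ : IsIso (A.π.map f) := by
      let t : A.π.mapCocone (colimit.cocone (K ⋙ ω)) ⟶ A.π.mapCocone (ω.mapCocone c) :=
        { hom := A.π.map f
          w := fun j => (A.π.map_comp _ _).symm.trans (congrArg A.π.map (colimit.ι_desc _ _)) }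
      have ht : IsIso t := IsColimit.hom_isIso
        (isColimitOfPreserves A.π (colimit.isColimit (K ⋙ ω)))
        (isColimitOfPreserves (ω ⋙ A.π) hc) t
      exact inferInstanceAs (IsIso ((Cocone.forget _).map t))
    have h₃ : f ≫ adj.unit.app (ω.obj c.pt) = adj.unit.app _ ≫ ω.map (A.π.map f) :=
      (adj.unit.naturality f)
    have h₄ : IsIso f := by
      have : IsIso (f ≫ adj.unit.app (ω.obj c.pt)) := by
        rw [h₃]; infer_instance
      exact IsIso.of_isIso_comp_right f (adj.unit.app (ω.obj c.pt))
    have h₅ : IsIso ((colimit.isColimit (K ⋙ ω)).desc (ω.mapCocone c)) := h₄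
    exact ⟨IsColimit.ofPointIso (colimit.isColimit (K ⋙ ω))⟩⟩⟩

omit [A.Coherent] in
lemma isSeparating_π_P : (ObjectProperty.ofObj fun i => A.π.obj (A.P i)).IsSeparating := by
  have := faithful_section adj
  intro Y Z f g h
  refine ω.map_injective (A.isSeparating_P _ _ ?_)
  rintro _ ⟨i⟩ k
  refine (adj.homEquiv _ _).symm.injective ?_
  rw [adj.homEquiv_naturality_right_symm, adj.homEquiv_naturality_right_symm]
  exact h _ ⟨i⟩ _

omit adj ω

/-- A reflective subcategory of `Gr A` with exact reflector inherits colimits and their exactness.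
-/
instance : IsGrothendieckAbelian.{u} A.QGr := by
  let adj := Adjunction.ofIsLeftAdjoint A.π
  have := full_section adj
  have := faithful_section adj
  let _ : Reflective A.π.rightAdjoint := ⟨_, adj⟩
  have : HasColimitsOfSize.{u, u} A.QGr := hasColimits_of_reflective A.π.rightAdjoint
  have : HasFilteredColimitsOfSize.{u, u} A.QGr := ⟨fun _ _ _ => inferInstance⟩
  exact
    { locallySmall := locallySmall_of_faithful A.π.rightAdjoint
      hasFilteredColimitsOfSize := inferInstance
      ab5OfSize := ⟨fun J _ _ => adj.hasExactColimitsOfShape J⟩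
      hasSeparator := ⟨_, (isSeparating_π_P adj).isSeparator_coproduct⟩ }

end IndexedAlgebra

lemma coh_of_iso {C : Type*} [Category* C] {X Y : C} (e : X ≅ Y) (h : coh.{u} C X) :
    coh.{u} C Y := by
  refine ⟨?_, fun Z i _ hZ => h.2 Z (i ≫ e.inv) hZ⟩
  have := h.1
  have := Cardinal.fact_isRegular_aleph0.{u}
  exact isCardinalPresentable_of_iso e Cardinal.aleph0.{u}

/-- An exact functor between abelian categories is faithful if it reflects zero objects. -/
lemma faithful_of_isZero {C D : Type*} [Category* C] [Category* D] [Abelian C] [Abelian D]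
    (F : C ⥤ D) [PreservesFiniteLimits F] [PreservesFiniteColimits F]
    (hF : ∀ X, IsZero (F.obj X) → IsZero X) : F.Faithful := by
  have : F.Additive := Functor.additive_of_preserves_binary_products F
  suffices h : ∀ {X Y : C} (f : X ⟶ Y), F.map f = 0 → f = 0 from
    ⟨fun {X Y f g} hfg => sub_eq_zero.1 (h _ (by rw [F.map_sub, hfg, sub_self]))⟩
  intro X Y f hf
  have h : F.map (Abelian.factorThruImage f) ≫ F.map (Abelian.image.ι f) = 0 := by
    rw [← F.map_comp, Abelian.image.fac, hf]
  have h0 : IsZero (F.obj (Abelian.image f)) := by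
    rw [IsZero.iff_id_eq_zero, ← cancel_epi (F.map (Abelian.factorThruImage f)),
      ← cancel_mono (F.map (Abelian.image.ι f))]
    simpa using h
  rw [← Abelian.image.fac f, (hF _ h0).eq_of_tgt (Abelian.factorThruImage f) 0, zero_comp]

namespace IndexedAlgebra

variable {I : Type u} (A : IndexedAlgebra I)

variable {A} in
lemma finGen_image {M N K : A.Gr} (hM : FinGen A.isFree M) (hN : FinGen A.isFree N) (a : M ⟶ K)
    (b : N ⟶ K) : FinGen A.isFree (Abelian.image (biprod.desc a b)) := by
  refine hM.of_cover A.isFree_biprod hN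
    (biprod.inl ≫ Abelian.factorThruImage (biprod.desc a b))
    (biprod.inr ≫ Abelian.factorThruImage (biprod.desc a b)) ?_
  rw [show biprod.desc (biprod.inl ≫ Abelian.factorThruImage (biprod.desc a b))
    (biprod.inr ≫ Abelian.factorThruImage (biprod.desc a b)) =
      Abelian.factorThruImage (biprod.desc a b) from biprod.hom_ext' _ _ (by simp) (by simp)]
  infer_instance

variable [PartialOrder I] [IsDirectedOrder I] [Nonempty I] [A.PositivelyIndexed]
variable [A.TailsCocompact] [A.Coherent]

/-! ### Coherent objects of the quotient category. -/

section Coherence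

variable {A}

/-- Sharper than `isSeparating_π_P`: only morphisms coming from module maps `P i ⟶ N` are tested. -/
lemma π_hom_ext_P {N : A.Gr} {Y : A.QGr} {f g : A.π.obj N ⟶ Y}
    (h : ∀ i (p : A.P i ⟶ N), A.π.map p ≫ f = A.π.map p ≫ g) : f = g := by
  let adj := Adjunction.ofIsLeftAdjoint A.π
  refine (adj.homEquiv _ _).injective (A.isSeparating_P _ _ ?_)
  rintro _ ⟨i⟩ p
  rw [← adj.homEquiv_naturality_left, ← adj.homEquiv_naturality_left, h]

/-- The finitely generated objects among those of the form `π N` are the images of finitely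
generated submodules. -/
lemma exists_isIso_of_isFinGenObj {N : A.Gr} {Y : A.QGr} (t : A.π.obj N ⟶ Y) [IsIso t]
    (hY : isFinGenObj A.QGr Y) :
    ∃ (Z : A.Gr) (_ : FinGen A.isFree Z) (a : Z ⟶ N) (_ : Mono a), IsIso (A.π.map a ≫ t) := by
  let s : Set (Subobject Y) := { V | ∃ (Z : A.Gr) (_ : FinGen A.isFree Z) (a : Z ⟶ N)
    (_ : Mono a), V = Subobject.mk (A.π.map a ≫ t) }
  have hs : s.Nonempty := ⟨_, 0, ⟨0, A.isFree_zero, 𝟙 _, inferInstance⟩, 0,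
    ⟨fun _ _ _ => (isZero_zero _).eq_of_tgt _ _⟩, rfl⟩
  have hdir : DirectedOn (· ≤ ·) s := by
    rintro _ ⟨Z, hZ, a, ha, rfl⟩ _ ⟨Z', hZ', a', ha', rfl⟩
    refine ⟨_, ⟨_, finGen_image hZ hZ' a a', Abelian.image.ι _, inferInstance, rfl⟩, ?_, ?_⟩
    · refine Subobject.mk_le_mk_of_comm
        (A.π.map (biprod.inl ≫ Abelian.factorThruImage (biprod.desc a a'))) ?_
      rw [← Category.assoc, ← A.π.map_comp, Category.assoc, Abelian.image.fac, biprod.inl_desc]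
    · refine Subobject.mk_le_mk_of_comm
        (A.π.map (biprod.inr ≫ Abelian.factorThruImage (biprod.desc a a'))) ?_
      rw [← Category.assoc, ← A.π.map_comp, Category.assoc, Abelian.image.fac, biprod.inr_desc]
  have htop : IsLUB s ⊤ := by
    refine ⟨fun _ _ => le_top, fun V hV => ?_⟩
    -- Every `P i ⟶ N` has finitely generated image, whose subobject lies below the upper bound `V`;
    -- so `V` contains enough to separate morphisms out of `Y`.
    have : Epi V.arrow := ⟨fun f g h => by
      rw [← cancel_epi t]
      refine π_hom_ext_P fun i p => ?_
      have hi : FinGen A.isFree (Abelian.image p) :=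
        FinGen.of_epi (Abelian.factorThruImage p) ⟨_, A.isFree_P i, 𝟙 _, inferInstance⟩
      have hle := hV ⟨_, hi, Abelian.image.ι p, inferInstance, rfl⟩
      have e : A.π.map p ≫ t = A.π.map (Abelian.factorThruImage p) ≫
          Subobject.ofMkLE _ _ hle ≫ V.arrow := by
        rw [Subobject.ofMkLE_arrow, ← Category.assoc, ← A.π.map_comp, Abelian.image.fac]
      rw [reassoc_of% e, reassoc_of% e, h]⟩
    have : IsIso V.arrow := isIso_of_mono_of_epi _
    exact (Subobject.eq_top_of_isIso_arrow V).ge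
  obtain ⟨_, ⟨Z, hZ, a, ha, rfl⟩, hV⟩ := hY s ⊤ hs hdir htop le_rfl
  exact ⟨Z, hZ, a, ha, (Subobject.isIso_iff_mk_eq_top _).2 (top_le_iff.1 hV)⟩

lemma isFinitelyPresentable_π {X : A.Gr} (hX : A.isFinPres X) :
    IsFinitelyPresentable.{u} (A.π.obj X) := by
  let adj := Adjunction.ofIsLeftAdjoint A.π
  have := Cardinal.fact_isRegular_aleph0.{u}
  have := A.isFinitelyPresentable_of_isFinPres hX
  have : A.π.rightAdjoint.IsCardinalAccessible Cardinal.aleph0.{u} :=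
    Functor.IsFinitelyAccessible_iff_preservesFilteredColimitsOfSize.2
      (preservesFilteredColimits_section adj)
  exact adj.isCardinalPresentable_leftAdjoint_obj Cardinal.aleph0.{u} X

/-- A subobject `Y` of `π X` is the image under `π` of the submodule of `X` obtained by pulling `ω
Y` back along the unit. If `Y` is finitely generated, a finitely generated submodule already gives
`Y`, and it is finitely presented because `X` is coherent. -/
lemma coh_π {X : A.Gr} (hX : A.isFinPres X) : coh.{u} A.QGr (A.π.obj X) := by
  refine ⟨isFinitelyPresentable_π hX, fun Y i _ hY => ?_⟩
  let adj := Adjunction.ofIsLeftAdjoint A.π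
  have := isIso_counit adj
  have := isIso_π_map_unit adj X
  have : IsIso (A.π.map (pullback.snd (adj.unit.app X) (A.π.rightAdjoint.map i))) :=
    ((IsPullback.of_hasPullback (adj.unit.app X) (A.π.rightAdjoint.map i)).map
      A.π).isIso_snd_of_isIso
  let t := A.π.map (pullback.snd (adj.unit.app X) (A.π.rightAdjoint.map i)) ≫ adj.counit.app Y
  obtain ⟨Z, hZ, a, _, h⟩ := exists_isIso_of_isFinGenObj t hY
  have hZ' := (hX.cohMod A.isFree_biprod A.projective_of_isFree A.isFree_le_isCohMod).of_subobject
    (a ≫ pullback.fst (adj.unit.app X) (A.π.rightAdjoint.map i)) hZ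
  have := isFinitelyPresentable_π hZ'.finPres
  have := Cardinal.fact_isRegular_aleph0.{u}
  exact isCardinalPresentable_of_iso (asIso (A.π.map a ≫ t)) Cardinal.aleph0.{u}

end Coherence

lemma isLocallyCoherent_QGr : IsLocallyCoherent.{u} A.QGr :=
  ⟨inferInstance, I, fun i => A.π.obj (A.P i), fun i => coh_π (A.isFinPres_of_isFree _ (A.isFree_P i)),
    isSeparating_π_P (Adjunction.ofIsLeftAdjoint A.π)⟩

/-! ### Comparison of `qgr A` with the coherent objects of `QGr A`. -/

section Comparison

lemma isInvertedBy_ι_comp_π : A.tors.isoModSerre.IsInvertedBy (A.ι ⋙ A.π) :=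
  (ObjectProperty.isoModSerre_isInvertedBy_iff A.tors (A.ι ⋙ A.π)).2 fun _ hX =>
    (ObjectProperty.SerreClassLocalization.isZero_obj_iff A.π A.Tors _).2 hX

/-- The exact functor `qgr A ⥤ QGr A` induced by the inclusion `gr A ⥤ Gr A`. -/
noncomputable def qgrι : A.qgr ⥤ A.QGr :=
  Localization.Construction.lift (A.ι ⋙ A.π) A.isInvertedBy_ι_comp_π

/-- An equality of functors, not just an isomorphism, because the lift to the constructed
localization is strict. -/
lemma πqgr_comp_qgrι : A.πqgr ⋙ A.qgrι = A.ι ⋙ A.π :=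
  Localization.Construction.fac _ _

/-- Exactness out of a Serre quotient can be tested after composing with the quotient functor, where
it is that of `A.ι ⋙ A.π`. -/
instance : PreservesFiniteLimits A.qgrι := by
  rw [← ObjectProperty.SerreClassLocalization.preservesFiniteLimits_comp_iff A.πqgr A.tors,
    πqgr_comp_qgrι]
  infer_instance

instance : PreservesFiniteColimits A.qgrι := by
  rw [← ObjectProperty.SerreClassLocalization.preservesFiniteColimits_comp_iff A.πqgr A.tors,
    πqgr_comp_qgrι]
  infer_instance

/-- The compatibility of `qgrι` with the quotient functors. -/
noncomputable def qgrιIso : A.πqgr ⋙ A.qgrι ≅ A.ι ⋙ A.π := eqToIso A.πqgr_comp_qgrι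

instance : A.qgrι.Faithful := faithful_of_isZero _ fun X hX => by
  have := Localization.essSurj A.πqgr A.tors.isoModSerre
  let e := A.πqgr.objObjPreimageIso X
  refine IsZero.of_iso ?_ e.symm
  refine (ObjectProperty.SerreClassLocalization.isZero_obj_iff A.πqgr A.tors _).2 ?_
  exact (ObjectProperty.SerreClassLocalization.isZero_obj_iff A.π A.Tors _).1
    (hX.of_iso ((A.qgrιIso.app _).symm ≪≫ A.qgrι.mapIso e))

/-- A morphism in `QGr A` between images of finitely presented modules is a right fraction whose
source can be taken finitely presented, so numerator and denominator both live in `gr A`. -/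
instance : A.qgrι.Full where
  map_surjective {X Y} f := by
    have := Localization.essSurj A.πqgr A.tors.isoModSerre
    let e := A.πqgr.objObjPreimageIso X
    let e' := A.πqgr.objObjPreimageIso Y
    let i := (A.qgrιIso.app _).symm ≪≫ A.qgrι.mapIso e
    let i' := (A.qgrιIso.app _).symm ≪≫ A.qgrι.mapIso e'
    obtain ⟨Z, hZ, s, hs, g, h⟩ := A.exists_rightFraction_isFinPres
      (A.πqgr.objPreimage X).property (i.hom ≫ f ≫ i'.inv)
    let Z' : A.gr := ⟨Z, hZ⟩
    let s' : Z' ⟶ A.πqgr.objPreimage X := ObjectProperty.homMk s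
    let g' : Z' ⟶ A.πqgr.objPreimage Y := ObjectProperty.homMk g
    have hnat {U V : A.gr} (k : U ⟶ V) : A.qgrι.map (A.πqgr.map k) =
        A.qgrιIso.hom.app U ≫ A.π.map k.hom ≫ A.qgrιIso.inv.app V := by
      have := A.qgrιIso.hom.naturality k
      rw [← Category.assoc, ← Iso.app_inv, Iso.eq_comp_inv]
      exact this
    have := Localization.inverts A.π A.Tors.isoModSerre s hs
    have : IsIso (A.qgrι.map (A.πqgr.map s')) := by
      rw [hnat]
      have : IsIso (A.π.map s'.hom) := this
      infer_instance
    -- A faithful functor out of an abelian category reflects isomorphisms.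
    have := isIso_of_reflects_iso (A.πqgr.map s') A.qgrι
    refine ⟨e.inv ≫ inv (A.πqgr.map s') ≫ A.πqgr.map g' ≫ e'.hom, ?_⟩
    have h' : A.qgrι.map (A.πqgr.map s') ≫ A.qgrι.map e.hom ≫ f =
        A.qgrι.map (A.πqgr.map g') ≫ A.qgrι.map e'.hom := by
      have h'' : A.π.map s'.hom ≫ i.hom ≫ f ≫ i'.inv = A.π.map g'.hom := h
      rw [hnat, hnat, ← h'']
      simp [i, i']
    rw [Functor.map_comp, Functor.map_comp, Functor.map_comp, Functor.map_inv, ← h',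
      IsIso.inv_hom_id_assoc, ← Category.assoc, ← Functor.map_comp, e.inv_hom_id]
    exact (congrArg (· ≫ f) (A.qgrι.map_id X)).trans (Category.id_comp f)

lemma coh_qgrι (X : A.qgr) : coh.{u} A.QGr (A.qgrι.obj X) := by
  have := Localization.essSurj A.πqgr A.tors.isoModSerre
  exact coh_of_iso ((A.qgrιIso.app _).symm ≪≫ A.qgrι.mapIso (A.πqgr.objObjPreimageIso X))
    (coh_π (A.πqgr.objPreimage X).property)

lemma exists_iso_qgrι (Y : A.QGr) [IsFinitelyPresentable.{u} Y] :
    ∃ X, Nonempty (A.qgrι.obj X ≅ Y) := by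
  let adj := Adjunction.ofIsLeftAdjoint A.π
  have := isIso_counit adj
  obtain ⟨J, _, _, _, ⟨p⟩⟩ := A.directedColimits_isFinPres (A.π.rightAdjoint.obj Y)
  -- `Y ≅ π ω Y` is the colimit of the images of finitely presented modules, so the inverse counit
  -- factors through one stage and `Y` is a retract of it. The idempotent `r ≫ i` comes from `qgr A`
  -- by full faithfulness and splits there.
  obtain ⟨j, a, ha⟩ := IsFinitelyPresentable.exists_hom_of_isColimit
    (isColimitOfPreserves A.π p.isColimit) (inv (adj.counit.app Y))
  let N : A.gr := ⟨p.diag.obj j, p.prop_diag_obj j⟩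
  let n : A.qgrι.obj (A.πqgr.obj N) ≅ A.π.obj (p.diag.obj j) := A.qgrιIso.app N
  let i : Y ⟶ A.qgrι.obj (A.πqgr.obj N) := a ≫ n.inv
  let r : A.qgrι.obj (A.πqgr.obj N) ⟶ Y := n.hom ≫ A.π.map (p.ι.app j) ≫ adj.counit.app Y
  have hir : i ≫ r = 𝟙 Y := by
    have ha' : a ≫ A.π.map (p.ι.app j) = inv (adj.counit.app Y) := ha
    simp [i, r, reassoc_of% ha']
  obtain ⟨X, k, q, hkq, hqk⟩ := IsIdempotentComplete.idempotents_split (A.πqgr.obj N)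
    (A.qgrι.preimage (r ≫ i)) (A.qgrι.map_injective (by simp [reassoc_of% hir]))
  have hqk' : A.qgrι.map q ≫ A.qgrι.map k = r ≫ i := by
    rw [← Functor.map_comp, hqk, Functor.map_preimage]
  have hkq' : A.qgrι.map k ≫ A.qgrι.map q = 𝟙 _ := by
    rw [← Functor.map_comp, hkq]
    exact A.qgrι.map_id _
  refine ⟨X, ⟨⟨A.qgrι.map k ≫ r, i ≫ A.qgrι.map q, ?_, ?_⟩⟩⟩
  · rw [Category.assoc, ← reassoc_of% hqk', hkq', Category.comp_id, hkq']
  · rw [Category.assoc, reassoc_of% hqk', hir, Category.comp_id, hir]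

/-- The functor `qgr A ⥤ coh (QGr A)`. -/
noncomputable abbrev qgrToCoh : A.qgr ⥤ (coh.{u} A.QGr).FullSubcategory :=
  (coh.{u} A.QGr).lift A.qgrι A.coh_qgrι

instance : A.qgrToCoh.EssSurj where
  mem_essImage Y := by
    -- Finite presentability of `Y` alone is enough.
    have := Y.property.1
    obtain ⟨X, ⟨e⟩⟩ := A.exists_iso_qgrι Y.obj
    exact ⟨X, ⟨(coh.{u} A.QGr).fullyFaithfulι.preimageIso e⟩⟩

instance : A.qgrToCoh.IsEquivalence where

end Comparison

end IndexedAlgebra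

end NCProj

theorem corollary3p17 {I : Type u} [PartialOrder I] [Nonempty I] [IsDirectedOrder I]
    (hI : ∀ i j : I, (Set.Icc i j).Finite)
    (A : NCProj.IndexedAlgebra I) [A.Connected] [A.PositivelyIndexed] [A.TailsCocompact]
    [A.Coherent] :
    -- (1) `tors A` is a Serre subcategory of `gr A`; `Tors A` consists of the directed colimits of
    -- objects of `tors A`, and it is closed under directed colimits.
    (A.tors.IsSerreClass ∧
      A.Tors = NCProj.directedColimits.{u} (A.tors.map A.ι) ∧
      NCProj.directedColimits.{u} A.Tors ≤ A.Tors) ∧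
    -- (2) The section functor, i.e. the right adjoint of `π`, exists and preserves directed
    -- (equivalently, filtered) colimits.
    (A.π.IsLeftAdjoint ∧
      ∀ (ω : A.QGr ⥤ A.Gr) (_ : A.π ⊣ ω), PreservesFilteredColimitsOfSize.{u, u} ω) ∧
    -- (3) `QGr A` is locally coherent and `Φ : qgr A ≌ coh (QGr A)`.
    NCProj.IsLocallyCoherent.{u} A.QGr ∧
    ∃ Φ : A.qgr ≌ (NCProj.coh.{u} A.QGr).FullSubcategory,
      -- (4) The composition of `Φ` with the inclusion is exact, fully faithful and compatible
      -- with the quotient functors.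
      PreservesFiniteLimits (Φ.functor ⋙ (NCProj.coh.{u} A.QGr).ι) ∧
      PreservesFiniteColimits (Φ.functor ⋙ (NCProj.coh.{u} A.QGr).ι) ∧
      (Φ.functor ⋙ (NCProj.coh.{u} A.QGr).ι).Full ∧
      (Φ.functor ⋙ (NCProj.coh.{u} A.QGr).ι).Faithful ∧
      A.ι ⋙ A.π = A.πqgr ⋙ Φ.functor ⋙ (NCProj.coh.{u} A.QGr).ι :=
  ⟨⟨inferInstance, A.Tors_eq_directedColimits, A.directedColimits_Tors_le⟩,
    ⟨inferInstance, fun _ adj => NCProj.IndexedAlgebra.preservesFilteredColimits_section adj⟩,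
    A.isLocallyCoherent_QGr, A.qgrToCoh.asEquivalence,
    -- `A.qgrToCoh` followed by the inclusion is `A.qgrι` by definition.
    inferInstanceAs (PreservesFiniteLimits A.qgrι),
    inferInstanceAs (PreservesFiniteColimits A.qgrι),
    inferInstanceAs A.qgrι.Full, inferInstanceAs A.qgrι.Faithful, A.πqgr_comp_qgrι.symm⟩
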